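/- **Setting.** We observe i.i.d. pairs $(X_1,W_1),\dots,(X_n,W_n)$ with values in $\mathbb R^{d_X}\times\mathbb R^{d_W}$ and distribution $P\in\mathcal P$, a class of probability measures. Let $\Theta\subseteq\mathbb R^d$ be a Borel set, $m:\mathbb R^{d_W}\times\Theta\to\mathbb R^{d_Y}$ a measurable function, and $\mathcal G$ a class of functions $g=(g_1,\dots,g_{d_Y}):\mathbb R^{d_X}\to\mathbb R^{d_Y}$ that is the range of a jointly measurable family indexed by a standard Borel space. The identified set is $$\Theta_0(P)=\{\theta\in\Theta:\ E_P[m(W,\theta)\mid X]\ge 0\ \text{ $P$-a.s.}\}.$$ Write $E_n$ for the sample mean, $\hat\mu_{n,j}(\theta,g)=E_n m_j(W_i,\theta)g_j(X_i)$ and $\hat\sigma_{n,j}(\theta,g)=\{E_n[m_j(W_i,\theta)g_j(X_i)]^2-[E_nm_j(W_i,\theta)g_j(X_i)]^2\}^{1/2}$. For a function $S:\mathbb R^{d_Y}\to[0,\infty)$ and truncation points $\sigma_n$ (possibly data dependent) let $$T_n(\theta)=\sup_{g\in\mathcal G}S\Big(\frac{\hat\mu_{n,1}(\theta,g)}{\hat\sigma_{n,1}(\theta,g)\vee\sigma_n},\dots,\frac{\hat\mu_{n,d_Y}(\theta,g)}{\hat\sigma_{n,d_Y}(\theta,g)\vee\sigma_n}\Big),\qquad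 \mathcal C_n(c)=\Big\{\theta\in\Theta:\ \tfrac{\sqrt n}{\sqrt{\log n}}\,T_n(\theta)\le c\Big\}.$$ Let $d_H(A,B)=\max\{\sup_{a\in A}\inf_{b\in B}\|a-b\|,\ \sup_{b\in B}\inf_{a\in A}\|a-b\|\}\in[0,\infty]$ be the Hausdorff distance, and $d(\theta,B)=\inf_{b\in B}\|\theta-b\|$ (an infimum over the empty set is $+\infty$ and a supremum over it is $0$). For events that need not be measurable, $P$ denotes outer probability. **Theorem.** For all $V>0$, $\overline Y\ge 0$ and $K_{S,1}>0$ there is a constant $K_0=K_0(V,\overline Y,K_{S,1})$ such that the following holds for every $K>K_0$. Assume: 1. $g_j(X)\ge 0$ $P$-a.s. for all $j$, $g\in\mathcal G$ and $P\in\mathcal P$. 2. For some $A>0$ and every $j$, the classes $\mathcal F_{j,1}=\{s\,m_j(W,\theta)g_j(X)+t:\theta\in\Theta,\ g\in\mathcal G,\ s,t\in[-(\overline Y\vee1),\overline Y\vee1]\}$ and $\mathcal F_{j,2}=\{f^2: f\in\mathcal F_{j,1}\}$ satisfy $\sup_Q N(\varepsilon,\mathcal F_{j,i},L_1(Q))\le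 A\varepsilon^{-V}$ for $0<\varepsilon<1$, $i=1,2$. Here $Q$ ranges over all probability measures, and $N(\varepsilon,\mathcal F,L_1(Q))$ is the smallest number of functions in $L_1(Q)$ (not necessarily in $\mathcal F$) such that each $f\in\mathcal F$ is within $L_1(Q)$-distance $\varepsilon$ of one of them. 3. $|m_j(W,\theta)g_j(X)|\le\overline Y$ $P$-a.s. for all $j$, $\theta\in\Theta$, $g\in\mathcal G$ and $P\in\mathcal P$. 4. $S(t)>0$ if and only if $t_j<0$ for some $j$; and, for some $K_{S,2}>0$ and every $c>0$, $S(t)\ge c$ implies $t_j\le -cK_{S,1}$ for some $j$, and $S(t)\le c$ implies $t_j\ge -cK_{S,2}$ for all $j$. 5. $\sigma_n$ is bounded from above and $\sigma_n\sqrt{n/\log n}\ge\hat a_n$ for some possibly data dependent $\hat a_n$ ($n\ge2$). The data dependent values $\hat a_n$ and $\hat c_n$ satisfy $\hat a_n\ge K$ and $\hat c_n\ge K$ with probability approaching one uniformly in $P$, that is, $\sup_{P\in\mathcal P}P(\hat a_n<K\text{ or }\hat c_n<K)\to0$. 6. For every $\varepsilon>0$ there is a $\delta>0$ such that, for all $P\in\mathcal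 P$ and $\theta\in\Theta$, $d(\theta,\Theta_0(P))>\varepsilon$ implies that $E_Pm_j(W,\theta)g_j(X)<-\delta$ for some $g\in\mathcal G$ and some $j$. 7. $\sup_{P\in\mathcal P}P\big(\hat c_n\sqrt{(\log n)/n}>\eta\big)\to0$ for every $\eta>0$. Then, for every $\varepsilon>0$, $$\sup_{P\in\mathcal P}P\big(d_H(\Theta_0(P),\mathcal C_n(\hat c_n))>\varepsilon\big)\longrightarrow 0\qquad(n\to\infty).$$ -/

import Mathlib

open MeasureTheory ProbabilityTheory Filter Topology Set
open scoped ENNReal NNReal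

noncomputable section

namespace CondMomIneq

/-- The space of one observation `(X, W)`, with `X ∈ ℝ^dX` and `W ∈ ℝ^dW`. -/
abbrev Obs (dX dW : ℕ) : Type :=
  EuclideanSpace ℝ (Fin dX) × EuclideanSpace ℝ (Fin dW)

/-- The data of a conditional moment inequality problem: a parameter set `Θ ⊆ ℝ^d`, a moment
function `m : ℝ^dW × Θ → ℝ^dY` (only its values on `Θ` are ever used), a class `G` of instrument
functions `g = (g_1, …, g_dY)` on `ℝ^dX`, and a class `P` of probability distributions of
one observation. -/
structure Model (dX dW dY d : ℕ) where
  Θ : Set (EuclideanSpace ℝ (Fin d))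
  m : EuclideanSpace ℝ (Fin dW) → EuclideanSpace ℝ (Fin d) → Fin dY → ℝ
  G : Set (EuclideanSpace ℝ (Fin dX) → Fin dY → ℝ)
  P : Set (ProbabilityMeasure (Obs dX dW))

/-! ### Sample quantities, for an arbitrary observation space -/

section Sample

variable {Z : Type*}

/-- The sample mean `E_n f` for the sample `z = (z_1, …, z_n)`. -/
def empMean {n : ℕ} (z : Fin n → Z) (f : Z → ℝ) : ℝ :=
  (∑ i, f (z i)) / n

/-- The sample standard deviation `{E_n f² - (E_n f)²}^{1/2}`. -/
def empSD {n : ℕ} (z : Fin n → Z) (f : Z → ℝ) : ℝ :=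
  √(empMean z (fun x => f x ^ 2) - empMean z f ^ 2)

/-- The `L_1(Q)` covering number of a class of functions: the smallest `k` for which there are
`k` functions in `L_1(Q)` (not necessarily in the class) such that every member of the class is
within `L_1(Q)` distance `ε` of one of them; infinite if there is no such `k`. -/
def coveringNumber [MeasurableSpace Z] (ε : ℝ) (F : Set (Z → ℝ)) (Q : Measure Z) : ℕ∞ :=
  sInf {N : ℕ∞ | ∃ (k : ℕ) (φ : Fin k → Z → ℝ), N = k ∧ (∀ i, Integrable (φ i) Q) ∧
    ∀ f ∈ F, ∃ i, eLpNorm (f - φ i) 1 Q ≤ ENNReal.ofReal ε}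

/-- `sup_Q N(ε, F, L_1(Q)) ≤ A ε^{-V}` for `0 < ε < 1`, the supremum being over all
probability measures `Q`. -/
def PolynomialCovering [MeasurableSpace Z] (F : Set (Z → ℝ)) (A V : ℝ) : Prop :=
  ∀ ε : ℝ, 0 < ε → ε < 1 → ∀ Q : ProbabilityMeasure Z,
    (coveringNumber ε F (Q : Measure Z) : ℝ≥0∞) ≤ ENNReal.ofReal (A * ε ^ (-V))

/-- `sup_{P ∈ Ps} P(E_n) → 0` as `n → ∞`, where `E_n` is an event about an i.i.d. sample of size
`n` from `P` (the event may depend on `P`). For a set that is not measurable, its outer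
probability is meant. -/
def UniformlyNegligible [MeasurableSpace Z] (Ps : Set (ProbabilityMeasure Z))
    (E : ProbabilityMeasure Z → (n : ℕ) → Set (Fin n → Z)) : Prop :=
  Tendsto (fun n : ℕ => ⨆ P ∈ Ps, (Measure.pi fun _ : Fin n => (P : Measure Z)) (E P n))
    atTop (𝓝 0)

end Sample

namespace Model

variable {dX dW dY d : ℕ} (M : Model dX dW dY d)

/-- The function `(x, w) ↦ m_j(w, θ) g_j(x)`. -/
def moment (θ : EuclideanSpace ℝ (Fin d)) (g : EuclideanSpace ℝ (Fin dX) → Fin dY → ℝ)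
    (j : Fin dY) : Obs dX dW → ℝ :=
  fun z => M.m z.2 θ j * g z.1 j

/-- Measurability of the primitives: `Θ` is a Borel set, `m` is a measurable function on
`ℝ^dW × Θ`, and `G` is the range of a jointly measurable family indexed by a standard Borel
space. -/
def IsMeasurable : Prop :=
  MeasurableSet M.Θ ∧
  Measurable (fun p : EuclideanSpace ℝ (Fin dW) × M.Θ => M.m p.1 p.2) ∧
  ∃ (T : Type) (_ : MeasurableSpace T) (_ : StandardBorelSpace T)
    (γ : T → EuclideanSpace ℝ (Fin dX) → Fin dY → ℝ),
    Measurable (fun p : T × EuclideanSpace ℝ (Fin dX) => γ p.1 p.2) ∧ M.G = range γ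

/-- The identified set `Θ_0(P)`: the parameters `θ ∈ Θ` for which the conditional expectation
`E_P[m(W, θ) | X]` exists and is nonnegative in every component, `P`-almost surely. -/
def identifiedSet (P : ProbabilityMeasure (Obs dX dW)) : Set (EuclideanSpace ℝ (Fin d)) :=
  {θ | θ ∈ M.Θ ∧ ∀ j,
    Integrable (fun z : Obs dX dW => M.m z.2 θ j) (P : Measure (Obs dX dW)) ∧
    0 ≤ᵐ[(P : Measure (Obs dX dW))]
      (P : Measure (Obs dX dW))[fun z : Obs dX dW => M.m z.2 θ j |
        MeasurableSpace.comap (Prod.fst : Obs dX dW → EuclideanSpace ℝ (Fin dX)) inferInstance]}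

/-- The standard deviation weighted KS statistic `T_n(θ)`, with truncation point `σ`. -/
def ksStat (S : (Fin dY → ℝ) → ℝ≥0) {n : ℕ} (z : Fin n → Obs dX dW) (σ : ℝ)
    (θ : EuclideanSpace ℝ (Fin d)) : ℝ≥0∞ :=
  ⨆ g ∈ M.G, (S (fun j => empMean z (M.moment θ g j) / max (empSD z (M.moment θ g j)) σ) : ℝ≥0∞)

/-- The set estimate `C_n(c) = {θ ∈ Θ | (√n / √(log n)) T_n(θ) ≤ c}`. -/
def confRegion (S : (Fin dY → ℝ) → ℝ≥0) {n : ℕ} (z : Fin n → Obs dX dW) (σ c : ℝ) :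
    Set (EuclideanSpace ℝ (Fin d)) :=
  {θ | θ ∈ M.Θ ∧
    ((ENNReal.ofReal (√(n : ℝ) / √(Real.log n)) * M.ksStat S z σ θ : ℝ≥0∞) : EReal) ≤ (c : EReal)}

/-- The instruments are nonnegative: `g_j(X) ≥ 0` `P`-a.s. -/
def InstrumentsNonneg : Prop :=
  ∀ P ∈ M.P, ∀ g ∈ M.G, ∀ j, ∀ᵐ z ∂(P : Measure (Obs dX dW)), 0 ≤ g z.1 j

/-- The class `F_{j,1}` of functions `s m_j(W, θ) g_j(X) + t`, `s, t ∈ [-(Y ∨ 1), Y ∨ 1]`. -/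
def class₁ (Ybar : ℝ) (j : Fin dY) : Set (Obs dX dW → ℝ) :=
  {f | ∃ θ ∈ M.Θ, ∃ g ∈ M.G, ∃ s ∈ Icc (-(max Ybar 1)) (max Ybar 1),
    ∃ t ∈ Icc (-(max Ybar 1)) (max Ybar 1), f = fun z => s * M.moment θ g j z + t}

/-- The class `F_{j,2}` of squares of the members of `F_{j,1}`. -/
def class₂ (Ybar : ℝ) (j : Fin dY) : Set (Obs dX dW → ℝ) :=
  {f | ∃ θ ∈ M.Θ, ∃ g ∈ M.G, ∃ s ∈ Icc (-(max Ybar 1)) (max Ybar 1),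
    ∃ t ∈ Icc (-(max Ybar 1)) (max Ybar 1), f = fun z => (s * M.moment θ g j z + t) ^ 2}

/-- The covering number condition on the classes `F_{j,1}` and `F_{j,2}`. -/
def CoveringCondition (Ybar A V : ℝ) : Prop :=
  ∀ j, PolynomialCovering (M.class₁ Ybar j) A V ∧ PolynomialCovering (M.class₂ Ybar j) A V

/-- `|m_j(W, θ) g_j(X)| ≤ Y` `P`-a.s. -/
def BoundedMoments (Ybar : ℝ) : Prop :=
  ∀ P ∈ M.P, ∀ θ ∈ M.Θ, ∀ g ∈ M.G, ∀ j,
    ∀ᵐ z ∂(P : Measure (Obs dX dW)), |M.moment θ g j z| ≤ Ybar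

/-- For every `ε > 0` there is a `δ > 0` such that, for all `P` in the class, every `θ ∈ Θ` whose distance
to `Θ_0(P)` is greater than `ε` violates some unconditional moment inequality by more than `δ`.
The distance to the empty set is infinite. -/
def UniformViolation : Prop :=
  ∀ ε : ℝ, 0 < ε → ∃ δ : ℝ, 0 < δ ∧ ∀ P ∈ M.P, ∀ θ ∈ M.Θ,
    ENNReal.ofReal ε < Metric.infEDist θ (M.identifiedSet P) →
    ∃ g ∈ M.G, ∃ j, ∫ z, M.moment θ g j z ∂(P : Measure (Obs dX dW)) < -δ

/-- The truncation points are bounded from above, and `σ_n √(n / log n) ≥ a_n`. Both may be data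
dependent; since `log 1 = 0`, samples of size at least two are considered. -/
def CutoffCondition (σ a : (n : ℕ) → (Fin n → Obs dX dW) → ℝ) : Prop :=
  (∃ b : ℝ, ∀ n : ℕ, 2 ≤ n → ∀ P ∈ M.P,
    ∀ᵐ z ∂(Measure.pi fun _ : Fin n => (P : Measure (Obs dX dW))), σ n z ≤ b) ∧
  ∀ n : ℕ, 2 ≤ n → ∀ P ∈ M.P,
    ∀ᵐ z ∂(Measure.pi fun _ : Fin n => (P : Measure (Obs dX dW))),
      a n z ≤ σ n z * √((n : ℝ) / Real.log n)

end Model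

/-- The conditions on the function `S` that aggregates the components. -/
def AggregatorCondition {dY : ℕ} (S : (Fin dY → ℝ) → ℝ≥0) (KS1 KS2 : ℝ) : Prop :=
  (∀ t, 0 < S t ↔ ∃ j, t j < 0) ∧
  ∀ c : ℝ, 0 < c → ∀ t,
    (c ≤ (S t : ℝ) → ∃ j, t j ≤ -(c * KS1)) ∧ ((S t : ℝ) ≤ c → ∀ j, -(c * KS2) ≤ t j)

end CondMomIneq

end

namespace CondMomIneq

/-! ### Universal measurability of analytic sets -/

section Analytic

/-- Compactness of boxes in Baire space. -/
theorem isCompact_box (b : ℕ → ℕ) : IsCompact {x : ℕ → ℕ | ∀ i, x i ≤ b i} := by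
  have : {x : ℕ → ℕ | ∀ i, x i ≤ b i} = Set.pi univ fun i => Iic (b i) := by
    ext; simp [Pi.le_def]
  rw [this]
  exact isCompact_univ_pi fun i => (Set.finite_Iic (b i)).isCompact

/-- A neighbourhood of the image of the box below `b` contains the image of one of the sets
`{x | ∀ i < k, x i ≤ b i}`. -/
theorem exists_image_cylinder_subset {α : Type*} [TopologicalSpace α] {f : (ℕ → ℕ) → α}
    (hf : Continuous f) (b : ℕ → ℕ) {U : Set α} (hU : IsOpen U)
    (hbU : f '' {x | ∀ i, x i ≤ b i} ⊆ U) :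
    ∃ k, f '' {x | ∀ i < k, x i ≤ b i} ⊆ U := by
  by_contra! hcon
  have hx : ∀ k, ∃ x : ℕ → ℕ, (∀ i < k, x i ≤ b i) ∧ f x ∉ U := by
    intro k
    obtain ⟨_, ⟨x, hx, rfl⟩, hxU⟩ := Set.not_subset.1 (hcon k)
    exact ⟨x, hx, hxU⟩
  choose x hxb hxU using hx
  obtain ⟨y, hyK, φ, hφ, hlim⟩ := (isCompact_box b).tendsto_subseq
    (x := fun k i => min (x k i) (b i)) (fun k i => min_le_right _ _)
  have hlim' : Tendsto (fun k => x (φ k)) atTop (𝓝 y) := by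
    rw [tendsto_pi_nhds] at hlim ⊢
    intro i
    refine (hlim i).congr' ?_
    filter_upwards [eventually_gt_atTop i] with k hk
    exact min_eq_left (hxb _ _ (hk.trans_le (hφ.id_le k)))
  have hmem : ∀ᶠ k in atTop, f (x (φ k)) ∈ U :=
    ((hf.tendsto y).comp hlim').eventually (hU.mem_nhds (hbU ⟨y, hyK, rfl⟩))
  obtain ⟨k, hk⟩ := hmem.exists
  exact hxU _ hk

/-- A finite measure of the range of a continuous function on Baire space is approximated by the
measures of images of compact boxes. -/
theorem exists_box_measure_image_ge {α : Type*} [TopologicalSpace α] [PolishSpace α]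
    [MeasurableSpace α] [BorelSpace α] (μ : Measure α) [IsFiniteMeasure μ] {f : (ℕ → ℕ) → α}
    (hf : Continuous f) {r : ℝ≥0∞} (hr : r < μ (range f)) :
    ∃ b : ℕ → ℕ, r ≤ μ (f '' {x | ∀ i, x i ≤ b i}) := by
  have step : ∀ (k : ℕ) (g : ℕ → ℕ), r < μ (f '' {x | ∀ i < k, x i ≤ g i}) →
      ∃ m, r < μ (f '' {x | ∀ i < k + 1, x i ≤ Function.update g k m i}) := by
    intro k g hg
    have hun : f '' {x | ∀ i < k, x i ≤ g i} =
        ⋃ m, f '' {x | ∀ i < k + 1, x i ≤ Function.update g k m i} := by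
      rw [← Set.image_iUnion]
      congr 1
      ext x
      simp only [mem_ofPred_eq, mem_iUnion]
      constructor
      · intro h
        refine ⟨x k, fun i hi => ?_⟩
        rcases eq_or_ne i k with rfl | hne
        · simp
        · rw [Function.update_of_ne hne]
          exact h i (by omega)
      · rintro ⟨m, hm⟩ i hi
        have := hm i (by omega)
        rwa [Function.update_of_ne (by omega)] at this
    have hmono : Monotone fun m => f '' {x | ∀ i < k + 1, x i ≤ Function.update g k m i} := by
      intro m m' hmm
      refine Set.image_mono fun x hx i hi => (hx i hi).trans ?_
      rcases eq_or_ne i k with rfl | hne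
      · simpa using hmm
      · simp [Function.update_of_ne hne]
    rw [hun, hmono.measure_iUnion] at hg
    exact lt_iSup_iff.1 hg
  choose! m hm using step
  let G : ℕ → ℕ → ℕ := fun k => Nat.rec (fun _ => 0) (fun k g => Function.update g k (m k g)) k
  have hG : ∀ k, r < μ (f '' {x | ∀ i < k, x i ≤ G k i}) := by
    intro k
    induction k with
    | zero => simpa [Set.image_univ] using hr
    | succ k ih => exact hm k (G k) ih
  have hstable : ∀ k i, i < k → G k i = G (i + 1) i := by
    intro k i hik
    induction k with
    | zero => omega
    | succ k ih =>
      rcases (Nat.lt_succ_iff_lt_or_eq.1 hik) with h | rfl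
      · rw [← ih h]
        change Function.update (G k) k (m k (G k)) i = _
        rw [Function.update_of_ne (by omega)]
      · rfl
  refine ⟨fun i => G (i + 1) i, ?_⟩
  let := TopologicalSpace.upgradeIsCompletelyMetrizable α
  rw [Set.measure_eq_iInf_isOpen]
  refine le_iInf₂ fun U hU => le_iInf fun hUo => ?_
  obtain ⟨k, hk⟩ := exists_image_cylinder_subset hf _ hUo hU
  refine (hG k).le.trans (measure_mono (subset_trans ?_ hk))
  exact Set.image_mono fun x hx i hi => (hx i hi).trans_eq (hstable k i hi)

theorem _root_.MeasureTheory.AnalyticSet.nullMeasurableSet {α : Type*} [TopologicalSpace α]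
    [PolishSpace α] [MeasurableSpace α] [BorelSpace α] {s : Set α} (hs : AnalyticSet s)
    (μ : Measure α) [IsFiniteMeasure μ] : NullMeasurableSet s μ := by
  rw [AnalyticSet] at hs
  rcases hs with rfl | ⟨f, hf, rfl⟩
  · exact MeasurableSet.empty.nullMeasurableSet
  rcases eq_or_ne (μ (range f)) 0 with h0 | h0
  · exact NullMeasurableSet.of_null h0
  obtain ⟨u, -, hu, hulim⟩ := exists_seq_strictMono_tendsto' (pos_iff_ne_zero.2 h0)
  choose b hb using fun k => exists_box_measure_image_ge μ hf (hu k).2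
  have hmeas : ∀ k, MeasurableSet (f '' {x | ∀ i, x i ≤ b k i}) := by
    intro k
    exact ((isCompact_box _).image hf).isClosed.measurableSet
  have hsub : (⋃ k, f '' {x | ∀ i, x i ≤ b k i}) ⊆ range f :=
    iUnion_subset fun k => image_subset_range _ _
  refine ((MeasurableSet.iUnion hmeas).nullMeasurableSet (μ := μ)).congr
    (ae_eq_of_subset_of_measure_ge hsub ?_ (MeasurableSet.iUnion hmeas).nullMeasurableSet
      (measure_ne_top _ _))
  exact le_of_tendsto' hulim fun k => (hb k).trans (measure_mono (subset_iUnion (fun k => f '' {x | ∀ i, x i ≤ b k i}) k))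

/-- The projection of a measurable set along a standard Borel space is null measurable. -/
theorem nullMeasurableSet_exists {X I : Type*} [MeasurableSpace X] [StandardBorelSpace X]
    [MeasurableSpace I] [StandardBorelSpace I] (μ : Measure X) [IsFiniteMeasure μ]
    {p : X → I → Prop} (hp : MeasurableSet {q : X × I | p q.1 q.2}) :
    NullMeasurableSet {x | ∃ i, p x i} μ := by
  let := upgradeStandardBorel X
  have : {x | ∃ i, p x i} = Prod.fst '' {q : X × I | p q.1 q.2} := by
    ext x; simp
  rw [this]
  exact (hp.analyticSet_image measurable_fst).nullMeasurableSet μ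

end Analytic

/-! ### Symmetrization -/

section Symmetrization

/-- A null measurable event whose orbit under a finite family of measure preserving maps is thin
at every point has small probability. -/
theorem measure_le_of_card_orbit_le {Ω S : Type*} [MeasurableSpace Ω] [Fintype S] [Nonempty S]
    {ν : Measure Ω} [IsProbabilityMeasure ν] {τ : S → Ω → Ω}
    (hτ : ∀ s, MeasurePreserving (τ s) ν ν) {D : Set Ω} (hD : NullMeasurableSet D ν) {r : ℝ}
    (hr : 0 ≤ r) (h : ∀ ω, (Nat.card {s // τ s ω ∈ D} : ℝ) ≤ r * Fintype.card S) :
    ν D ≤ ENNReal.ofReal r := by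
  classical
  have hnull : ∀ s, NullMeasurableSet (τ s ⁻¹' D) ν :=
    fun s => hD.preimage (hτ s).quasiMeasurePreserving
  have hsum : ∑ s : S, ν (τ s ⁻¹' D) = (Fintype.card S : ℝ≥0∞) * ν D := by
    simp [fun s => (hτ s).measure_preimage hD]
  have hint : ∑ s : S, ν (τ s ⁻¹' D) ≤ ENNReal.ofReal (r * Fintype.card S) := by
    calc ∑ s : S, ν (τ s ⁻¹' D)
        = ∑ s : S, ∫⁻ ω, (τ s ⁻¹' D).indicator 1 ω ∂ν := by
          refine Finset.sum_congr rfl fun s _ => ?_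
          rw [lintegral_indicator_one₀ (hnull s)]
      _ = ∫⁻ ω, ∑ s : S, (τ s ⁻¹' D).indicator 1 ω ∂ν := by
          rw [lintegral_finsetSum']
          exact fun s _ => aemeasurable_one.indicator₀ (hnull s)
      _ ≤ ∫⁻ _, ENNReal.ofReal (r * Fintype.card S) ∂ν := by
          refine lintegral_mono fun ω => ?_
          have : ∑ s : S, (τ s ⁻¹' D).indicator (1 : Ω → ℝ≥0∞) ω
              = ((Nat.card {s // τ s ω ∈ D} : ℕ) : ℝ≥0∞) := by
            simp [Set.indicator_apply, Fintype.card_subtype]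
          rw [this, ← ENNReal.ofReal_natCast]
          exact ENNReal.ofReal_le_ofReal (h ω)
      _ = ENNReal.ofReal (r * Fintype.card S) := by simp
  rw [hsum, ENNReal.ofReal_mul hr, ENNReal.ofReal_natCast, mul_comm] at hint
  have hne : (Fintype.card S : ℝ≥0∞) ≠ 0 := by simp
  exact (ENNReal.mul_le_mul_iff_left hne (ENNReal.natCast_ne_top _)).1 hint

/-- Passing to a ghost sample: an event on one sample is controlled by an event on two samples,
provided that the latter has conditional probability at least one half. -/
theorem measure_le_two_mul_prod {Ω Ω' : Type*} [MeasurableSpace Ω] [MeasurableSpace Ω']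
    {μ : Measure Ω} {ν : Measure Ω'} [SFinite μ] [SFinite ν] {B : Set Ω} {D : Set (Ω × Ω')}
    (h : ∀ z ∈ B, 2⁻¹ ≤ ν {z' | (z, z') ∈ D}) : μ B ≤ 2 * (μ.prod ν) D := by
  set T := toMeasurable (μ.prod ν) D
  have hT : MeasurableSet T := measurableSet_toMeasurable _ _
  have hB : B ⊆ {z | 2⁻¹ ≤ ν (Prod.mk z ⁻¹' T)} := fun z hz =>
    (h z hz).trans (measure_mono fun z' hz' => subset_toMeasurable _ _ hz')
  have hmarkov := mul_meas_ge_le_lintegral (μ := μ)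
    (measurable_measure_prodMk_left (ν := ν) hT) 2⁻¹
  rw [← Measure.prod_apply hT, measure_toMeasurable] at hmarkov
  calc μ B ≤ μ {z | 2⁻¹ ≤ ν (Prod.mk z ⁻¹' T)} := measure_mono hB
    _ = 2 * (2⁻¹ * μ {z | 2⁻¹ ≤ ν (Prod.mk z ⁻¹' T)}) := by
        rw [← mul_assoc, ENNReal.mul_inv_cancel (by norm_num) (by norm_num), one_mul]
    _ ≤ 2 * (μ.prod ν) D := by gcongr

/-- The sum of the entries of `d` with signs prescribed by `s`. -/
def signedSum {n : ℕ} (s : Fin n → Bool) (d : Fin n → ℝ) : ℝ :=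
  ∑ j, if s j then d j else -d j

/-- Hoeffding's inequality for Rademacher sums, in self-normalized form. -/
theorem card_signedSum_gt_le {n : ℕ} (d : Fin n → ℝ) {x : ℝ} (hx : 0 ≤ x) :
    (Nat.card {s : Fin n → Bool // √(x * ∑ j, d j ^ 2) < signedSum s d} : ℝ)
      ≤ Real.exp (-(x / 2)) * 2 ^ n := by
  classical
  rw [Nat.card_eq_fintype_card, Fintype.card_subtype]
  set v := ∑ j, d j ^ 2 with hv
  have hv0 : 0 ≤ v := Finset.sum_nonneg fun j _ => sq_nonneg _
  rcases hv0.eq_or_lt with h0 | hpos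
  · have hd : ∀ j, d j = 0 := fun j => by
      have := (Finset.sum_eq_zero_iff_of_nonneg (fun j _ => sq_nonneg (d j))).1 h0.symm j
        (Finset.mem_univ j)
      exact pow_eq_zero_iff (two_ne_zero) |>.1 this
    have : (Finset.univ.filter fun s : Fin n → Bool => √(x * v) < signedSum s d) = ∅ := by
      ext s
      simp [signedSum, hd, ← h0]
    rw [this]
    simp only [Finset.card_empty, Nat.cast_zero]
    positivity
  have hmgf : ∀ l : ℝ, ∑ s : Fin n → Bool, Real.exp (l * signedSum s d)
      ≤ 2 ^ n * Real.exp (l ^ 2 * v / 2) := by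
    intro l
    calc ∑ s : Fin n → Bool, Real.exp (l * signedSum s d)
        = ∑ s : Fin n → Bool, ∏ j, Real.exp (l * if s j then d j else -d j) := by
          refine Finset.sum_congr rfl fun s _ => ?_
          rw [signedSum, Finset.mul_sum, Real.exp_sum]
      _ = ∏ j, ∑ b : Bool, Real.exp (l * if b then d j else -d j) := by
          rw [Finset.prod_univ_sum, Fintype.piFinset_univ]
      _ = ∏ j, (2 * Real.cosh (l * d j)) := by
          refine Finset.prod_congr rfl fun j _ => ?_
          rw [Real.cosh_eq]
          simp
          ring
      _ ≤ ∏ j, (2 * Real.exp ((l * d j) ^ 2 / 2)) := by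
          refine Finset.prod_le_prod (fun j _ => by positivity) fun j _ => ?_
          gcongr
          exact Real.cosh_le_exp_half_sq _
      _ = 2 ^ n * Real.exp (l ^ 2 * v / 2) := by
          rw [Finset.prod_mul_distrib, ← Real.exp_sum, hv, Finset.mul_sum, Finset.sum_div]
          simp [mul_pow]
  set l := √(x / v) with hl
  have hlv : l * √(x * v) = x := by
    rw [hl, ← Real.sqrt_mul (by positivity), show x / v * (x * v) = x * x by field_simp,
      Real.sqrt_mul_self hx]
  have hl2 : l ^ 2 * v = x := by
    rw [hl, Real.sq_sqrt (by positivity)]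
    field_simp
  have hcard : ((Finset.univ.filter fun s : Fin n → Bool => √(x * v) < signedSum s d).card : ℝ)
      * Real.exp x ≤ 2 ^ n * Real.exp (x / 2) := by
    calc _ = ∑ s ∈ Finset.univ.filter fun s : Fin n → Bool => √(x * v) < signedSum s d,
          Real.exp x := by rw [Finset.sum_const, nsmul_eq_mul]
      _ ≤ ∑ s ∈ Finset.univ.filter fun s : Fin n → Bool => √(x * v) < signedSum s d,
          Real.exp (l * signedSum s d) := by
          refine Finset.sum_le_sum fun s hs => Real.exp_le_exp.2 ?_
          rw [← hlv]
          exact mul_le_mul_of_nonneg_left (Finset.mem_filter.1 hs).2.le (Real.sqrt_nonneg _)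
      _ ≤ ∑ s : Fin n → Bool, Real.exp (l * signedSum s d) :=
          Finset.sum_le_sum_of_subset_of_nonneg (Finset.filter_subset _ _)
            fun _ _ _ => (Real.exp_pos _).le
      _ ≤ _ := by simpa [hl2] using hmgf l
  rw [← le_div_iff₀ (Real.exp_pos _)] at hcard
  refine hcard.trans_eq ?_
  rw [mul_div_assoc, ← Real.exp_sub, mul_comm]
  congr 2
  ring

variable {Z : Type*}

/-- Interchange of the entries of two samples at the places where `s` is false. -/
def swapAt {n : ℕ} (s : Fin n → Bool) (q : (Fin n → Z) × (Fin n → Z)) :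
    (Fin n → Z) × (Fin n → Z) :=
  (fun j => if s j then q.1 j else q.2 j, fun j => if s j then q.2 j else q.1 j)

theorem measurePreserving_swapAt [MeasurableSpace Z] (μ : Measure Z) [IsProbabilityMeasure μ]
    {n : ℕ} (s : Fin n → Bool) :
    MeasurePreserving (swapAt (Z := Z) s)
      ((Measure.pi fun _ : Fin n => μ).prod (Measure.pi fun _ : Fin n => μ))
      ((Measure.pi fun _ : Fin n => μ).prod (Measure.pi fun _ : Fin n => μ)) := by
  have hE := measurePreserving_arrowProdEquivProdArrow Z Z (Fin n) (fun _ => μ) (fun _ => μ)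
  have hmid : MeasurePreserving
      (fun (w : Fin n → Z × Z) j => (if s j then id else Prod.swap : Z × Z → Z × Z) (w j))
      (Measure.pi fun _ => μ.prod μ) (Measure.pi fun _ => μ.prod μ) := by
    refine measurePreserving_pi _ _ fun j => ?_
    by_cases h : s j
    · simpa [h] using MeasurePreserving.id (μ.prod μ)
    · simpa [h] using Measure.measurePreserving_swap (μ := μ) (ν := μ)
  convert hE.comp (hmid.comp (hE.symm _)) using 1
  funext q
  refine Prod.ext ?_ ?_ <;> funext j <;> by_cases h : s j <;>
    simp [swapAt, h, MeasurableEquiv.arrowProdEquivProdArrow, Equiv.arrowProdEquivProdArrow]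

/-- The increment of the empirical sum of `f` between two samples is large, relative to its
quadratic variation. -/
def Discrepant (c : ℝ) {n : ℕ} (q : (Fin n → Z) × (Fin n → Z)) (f : Z → ℝ) : Prop :=
  √(c * Real.log n * (∑ j, (f (q.2 j) - f (q.1 j)) ^ 2 + Real.log n))
    < ∑ j, (f (q.2 j) - f (q.1 j))

theorem discrepant_swapAt {c : ℝ} {n : ℕ} {s : Fin n → Bool} {q : (Fin n → Z) × (Fin n → Z)}
    {f : Z → ℝ} :
    Discrepant c (swapAt s q) f ↔
      √(c * Real.log n * (∑ j, (f (q.2 j) - f (q.1 j)) ^ 2 + Real.log n))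
        < signedSum s fun j => f (q.2 j) - f (q.1 j) := by
  have h1 : ∀ j, f ((swapAt s q).2 j) - f ((swapAt s q).1 j)
      = if s j then f (q.2 j) - f (q.1 j) else -(f (q.2 j) - f (q.1 j)) := by
    intro j
    by_cases h : s j <;> simp [swapAt, h]
  have h2 : ∀ j, (f ((swapAt s q).2 j) - f ((swapAt s q).1 j)) ^ 2
      = (f (q.2 j) - f (q.1 j)) ^ 2 := by
    intro j
    rw [h1]
    by_cases h : s j <;> simp [h]
    ring
  simp only [Discrepant, h2, signedSum]
  simp only [h1]

/-- The truncation of a real number to `[-B, B]`. -/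
def clip (B u : ℝ) : ℝ := max (-B) (min B u)

theorem abs_clip_le {B : ℝ} (hB : 0 ≤ B) (u : ℝ) : |clip B u| ≤ B :=
  abs_le.2 ⟨le_max_left _ _, max_le (by linarith) (min_le_left _ _)⟩

theorem clip_of_abs_le {B u : ℝ} (h : |u| ≤ B) : clip B u = u := by
  rw [clip, min_eq_right (abs_le.1 h).2, max_eq_right (abs_le.1 h).1]

theorem abs_clip_sub_clip_le (B u v : ℝ) : |clip B u - clip B v| ≤ |u - v| := by
  have h1 := abs_max_sub_max_le_max (-B) (min B u) (-B) (min B v)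
  have h2 := abs_min_sub_min_le_max B u B v
  simp only [sub_self, abs_zero, abs_nonneg, sup_of_le_right] at h1 h2
  exact h1.trans h2

/-- Polynomial `L_1` covering numbers of an indexed class with respect to the empirical measures
of finite families of points. -/
def EmpiricalCovering {I : Type*} (F : I → Z → ℝ) (A V : ℝ) : Prop :=
  ∀ ε : ℝ, 0 < ε → ε < 1 → ∀ (ι : Type) [Fintype ι] [Nonempty ι] (x : ι → Z),
    ∃ (k : ℕ) (φ : Fin k → ι → ℝ), (k : ℝ) ≤ A * ε ^ (-V) ∧
      ∀ i, ∃ l, ∑ j, |F i (x j) - φ l j| ≤ Fintype.card ι * ε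

/-- A large signed sum persists under a small perturbation in `ℓ_1`. -/
theorem signedSum_gt_of_close {n : ℕ} {s : Fin n → Bool} {e d : Fin n → ℝ} {B c ℓ : ℝ}
    (hB : 1 ≤ B) (hc : 1 ≤ c) (hℓ : 0 ≤ ℓ) (he : ∀ j, |e j| ≤ 2 * B) (hd : ∀ j, |d j| ≤ 2 * B)
    (hed : ∑ j, |e j - d j| ≤ ℓ / (4 * B))
    (h : √(c * ℓ * (∑ j, e j ^ 2 + ℓ)) < signedSum s e) :
    √(c / 4 * ℓ * ∑ j, d j ^ 2) < signedSum s d := by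
  have h1 : signedSum s e - ∑ j, |e j - d j| ≤ signedSum s d := by
    rw [signedSum, signedSum, ← Finset.sum_sub_distrib]
    refine Finset.sum_le_sum fun j _ => ?_
    split_ifs
    · linarith [le_abs_self (e j - d j)]
    · linarith [neg_abs_le (e j - d j)]
  have h2 : ∑ j, d j ^ 2 ≤ ∑ j, e j ^ 2 + ℓ := by
    have hle : ∑ j, d j ^ 2 ≤ ∑ j, (e j ^ 2 + 4 * B * |e j - d j|) := by
      refine Finset.sum_le_sum fun j _ => ?_
      have hsum : |d j + e j| ≤ 4 * B := by
        linarith [abs_add_le (d j) (e j), he j, hd j]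
      have : d j ^ 2 - e j ^ 2 ≤ |d j + e j| * |e j - d j| := by
        rw [← abs_mul]
        calc d j ^ 2 - e j ^ 2 = -((d j + e j) * (e j - d j)) := by ring
          _ ≤ _ := neg_le_abs _
      linarith [mul_le_mul_of_nonneg_right hsum (abs_nonneg (e j - d j))]
    rw [Finset.sum_add_distrib, ← Finset.mul_sum] at hle
    have : 4 * B * ∑ j, |e j - d j| ≤ 4 * B * (ℓ / (4 * B)) := by gcongr
    rw [mul_div_cancel₀ _ (by positivity)] at this
    linarith
  set v := ∑ j, e j ^ 2 with hv
  have hv0 : 0 ≤ v := Finset.sum_nonneg fun j _ => sq_nonneg _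
  have h3 : ℓ ≤ √(c * ℓ * (v + ℓ)) := by
    refine Real.le_sqrt_of_sq_le ?_
    nlinarith [mul_nonneg hℓ hv0, mul_nonneg hℓ hℓ, mul_nonneg (sub_nonneg.2 hc) (mul_nonneg hℓ hv0),
      mul_nonneg (sub_nonneg.2 hc) (mul_nonneg hℓ hℓ)]
  have h4 : ℓ / (4 * B) ≤ ℓ / 4 := by gcongr; linarith
  have h5 : √(c / 4 * ℓ * ∑ j, d j ^ 2) ≤ √(c * ℓ * (v + ℓ)) / 2 := by
    rw [← Real.sqrt_sq (by norm_num : (0 : ℝ) ≤ 2), ← Real.sqrt_div' _ (by norm_num)]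
    refine Real.sqrt_le_sqrt ?_
    calc c / 4 * ℓ * ∑ j, d j ^ 2 ≤ c / 4 * ℓ * (v + ℓ) := by gcongr
      _ = c * ℓ * (v + ℓ) / 2 ^ 2 := by ring
  linarith

/-- The number of signs for which some member of a class with polynomial covering numbers is
discrepant. -/
theorem card_discrepant_swapAt_le {I : Type*} {F : I → Z → ℝ} {A V B : ℝ} (hA : 0 < A)
    (hV : 0 < V) (hB : 1 ≤ B) (hF : EmpiricalCovering F A V) (hFB : ∀ i z, |F i z| ≤ B) {n : ℕ}
    (hn : 3 ≤ n) (q : (Fin n → Z) × (Fin n → Z)) :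
    (Nat.card {s : Fin n → Bool // ∃ i, Discrepant (16 * (V + 1)) (swapAt s q) (F i)} : ℝ)
      ≤ A * (8 * B) ^ V / n * 2 ^ n := by
  have hn0 : (0 : ℝ) < n := by positivity
  have hlog : 1 ≤ Real.log n := by
    rw [Real.le_log_iff_exp_le hn0]
    have : (3 : ℝ) ≤ n := by exact_mod_cast hn
    linarith [Real.exp_one_lt_d9]
  have hlogn : Real.log n ≤ n := (Real.log_le_sub_one_of_pos hn0).trans (by linarith)
  set ε := Real.log n / n / (8 * B) with hε
  have hε0 : 0 < ε := by positivity
  have hε1 : ε < 1 := by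
    rw [hε, div_lt_one (by positivity)]
    have : Real.log n / n ≤ 1 := (div_le_one hn0).2 hlogn
    linarith
  have : Nonempty (Fin n) := ⟨⟨0, by omega⟩⟩
  obtain ⟨k, φ, hk, hφ⟩ := hF ε hε0 hε1 (Fin n ⊕ Fin n) (Sum.elim q.1 q.2)
  let ψ : Fin k → Fin n ⊕ Fin n → ℝ := fun l j => clip B (φ l j)
  have hψB : ∀ l j, |ψ l j| ≤ B := fun l j =>
    abs_clip_le (by linarith) _
  have hψ : ∀ i, ∃ l, ∑ j, |F i (Sum.elim q.1 q.2 j) - ψ l j| ≤ 2 * n * ε := by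
    intro i
    obtain ⟨l, hl⟩ := hφ i
    refine ⟨l, (Finset.sum_le_sum fun j _ => ?_).trans (hl.trans_eq ?_)⟩
    · conv_lhs => rw [← clip_of_abs_le (hFB i (Sum.elim q.1 q.2 j))]
      exact abs_clip_sub_clip_le _ _ _
    · simp only [Fintype.card_sum, Fintype.card_fin, Nat.cast_add]
      ring
  let d : Fin k → Fin n → ℝ := fun l j => ψ l (Sum.inr j) - ψ l (Sum.inl j)
  have himp : ∀ s, (∃ i, Discrepant (16 * (V + 1)) (swapAt s q) (F i)) →
      ∃ l, √(4 * (V + 1) * Real.log n * ∑ j, d l j ^ 2) < signedSum s (d l) := by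
    rintro s ⟨i, hi⟩
    rw [discrepant_swapAt] at hi
    obtain ⟨l, hl⟩ := hψ i
    refine ⟨l, ?_⟩
    have h4 : 4 * (V + 1) = 16 * (V + 1) / 4 := by ring
    rw [h4]
    refine signedSum_gt_of_close hB (by linarith) (by linarith) (fun j => ?_) (fun j => ?_) ?_ hi
    · linarith [abs_sub (F i (q.2 j)) (F i (q.1 j)), hFB i (q.2 j), hFB i (q.1 j)]
    · linarith [abs_sub (ψ l (Sum.inr j)) (ψ l (Sum.inl j)), hψB l (Sum.inr j), hψB l (Sum.inl j)]
    · have h2 : 2 * n * ε = Real.log n / (4 * B) := by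
        rw [hε]; field_simp; ring
      rw [h2, Fintype.sum_sum_type, add_comm, ← Finset.sum_add_distrib] at hl
      refine (Finset.sum_le_sum fun j _ => ?_).trans hl
      refine le_trans (le_of_eq ?_) (abs_sub _ _)
      congr 1
      simp only [d, Sum.elim_inr, Sum.elim_inl]
      ring
  classical
  have hcard : (Nat.card {s : Fin n → Bool // ∃ i, Discrepant (16 * (V + 1)) (swapAt s q) (F i)} : ℝ)
      ≤ ∑ l : Fin k, (Nat.card {s : Fin n → Bool //
        √(4 * (V + 1) * Real.log n * ∑ j, d l j ^ 2) < signedSum s (d l)} : ℝ) := by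
    simp only [Nat.card_eq_fintype_card, Fintype.card_subtype]
    rw [← Nat.cast_sum]
    refine Nat.cast_le.2 ((Finset.card_le_card fun s hs => ?_).trans Finset.card_biUnion_le)
    obtain ⟨l, hl⟩ := himp s (Finset.mem_filter.1 hs).2
    simp only [Finset.mem_biUnion, Finset.mem_filter, Finset.mem_univ, true_and]
    exact ⟨l, hl⟩
  have hx : (0 : ℝ) ≤ 4 * (V + 1) * Real.log n := by positivity
  refine (hcard.trans (Finset.sum_le_sum fun l _ => card_signedSum_gt_le (d l) hx)).trans ?_
  rw [Finset.sum_const, Finset.card_univ, Fintype.card_fin, nsmul_eq_mul, ← mul_assoc]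
  refine mul_le_mul_of_nonneg_right ?_ (by positivity)
  have hpow : ε ^ (-V) ≤ (8 * B) ^ V * (n : ℝ) ^ V := by
    rw [Real.rpow_neg hε0.le, ← Real.inv_rpow hε0.le, ← Real.mul_rpow (by positivity) hn0.le]
    refine Real.rpow_le_rpow (by positivity) ?_ hV.le
    rw [hε, inv_div, div_div_eq_mul_div]
    exact div_le_self (by positivity) hlog
  have hexp : Real.exp (-(4 * (V + 1) * Real.log n / 2)) = (n : ℝ) ^ (-(2 * (V + 1))) := by
    rw [Real.rpow_def_of_pos hn0]
    congr 1
    ring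
  calc (k : ℝ) * Real.exp (-(4 * (V + 1) * Real.log n / 2))
      ≤ A * ((8 * B) ^ V * (n : ℝ) ^ V) * (n : ℝ) ^ (-(2 * (V + 1))) := by
        rw [hexp]
        gcongr
        exact hk.trans (by gcongr)
    _ = A * (8 * B) ^ V * (n : ℝ) ^ (-V - 2) := by
        rw [mul_assoc, mul_assoc ((8 * B) ^ V), ← Real.rpow_add hn0, ← mul_assoc]
        congr 2
        ring
    _ ≤ A * (8 * B) ^ V * (n : ℝ) ^ (-1 : ℝ) := by
        gcongr
        · exact_mod_cast (by omega : 1 ≤ n)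
        · linarith
    _ = A * (8 * B) ^ V / n := by
        rw [Real.rpow_neg_one, div_eq_mul_inv]

/-- Symmetrization inequality: in a class with polynomial covering numbers, discrepant functions
are unlikely. -/
theorem prod_discrepant_le [MeasurableSpace Z] [StandardBorelSpace Z] {I : Type*}
    [MeasurableSpace I] [StandardBorelSpace I] (μ : Measure Z) [IsProbabilityMeasure μ]
    {F : I → Z → ℝ} (hFm : Measurable (Function.uncurry F)) {A V B : ℝ} (hA : 0 < A)
    (hV : 0 < V) (hB : 1 ≤ B) (hF : EmpiricalCovering F A V) (hFB : ∀ i z, |F i z| ≤ B) {n : ℕ}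
    (hn : 3 ≤ n) :
    ((Measure.pi fun _ : Fin n => μ).prod (Measure.pi fun _ : Fin n => μ))
      {q | ∃ i, Discrepant (16 * (V + 1)) q (F i)} ≤ ENNReal.ofReal (A * (8 * B) ^ V / n) := by
  refine measure_le_of_card_orbit_le (S := Fin n → Bool) (measurePreserving_swapAt μ) ?_
    (by positivity) fun q => ?_
  · refine nullMeasurableSet_exists _ ?_
    have h1 : ∀ j : Fin n, Measurable fun p : ((Fin n → Z) × (Fin n → Z)) × I =>
        F p.2 (p.1.1 j) := fun j =>
      hFm.comp (measurable_snd.prodMk ((measurable_pi_apply j).comp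
        (measurable_fst.comp measurable_fst)))
    have h2 : ∀ j : Fin n, Measurable fun p : ((Fin n → Z) × (Fin n → Z)) × I =>
        F p.2 (p.1.2 j) := fun j =>
      hFm.comp (measurable_snd.prodMk ((measurable_pi_apply j).comp
        (measurable_snd.comp measurable_fst)))
    unfold Discrepant
    refine measurableSet_lt ?_ ?_
    · fun_prop
    · fun_prop
  · simpa using card_discrepant_swapAt_le hA hV hB hF hFB hn q

end Symmetrization

/-! ### Deviations of empirical means -/

section Deviation

variable {Z : Type*}

theorem empMean_mono {n : ℕ} (z : Fin n → Z) {f g : Z → ℝ} (h : ∀ j, f (z j) ≤ g (z j)) :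
    empMean z f ≤ empMean z g :=
  div_le_div_of_nonneg_right (Finset.sum_le_sum fun _ _ => h _) (Nat.cast_nonneg n)

theorem empMean_nonneg {n : ℕ} (z : Fin n → Z) {f : Z → ℝ} (h : ∀ x, 0 ≤ f x) :
    0 ≤ empMean z f :=
  div_nonneg (Finset.sum_nonneg fun _ _ => h _) (Nat.cast_nonneg n)

theorem sum_eq_mul_empMean {n : ℕ} (hn : 0 < n) (z : Fin n → Z) (f : Z → ℝ) :
    ∑ j, f (z j) = n * empMean z f := by
  have : (n : ℝ) ≠ 0 := by positivity
  rw [empMean, mul_div_cancel₀ _ this]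

theorem empMean_sub_sq {n : ℕ} (hn : 0 < n) (z : Fin n → Z) (f : Z → ℝ) (a : ℝ) :
    empMean z (fun x => (f x - a) ^ 2)
      = empMean z (fun x => f x ^ 2) - 2 * a * empMean z f + a ^ 2 := by
  have hn' : (n : ℝ) ≠ 0 := by positivity
  simp only [empMean, sub_sq, Finset.sum_add_distrib, Finset.sum_sub_distrib]
  have : ∑ j, 2 * f (z j) * a = 2 * a * ∑ j, f (z j) := by
    rw [Finset.mul_sum]
    exact Finset.sum_congr rfl fun j _ => by ring
  rw [this]
  simp only [Finset.sum_const, Finset.card_univ, Fintype.card_fin, nsmul_eq_mul]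
  field_simp

theorem empSD_sq {n : ℕ} (hn : 0 < n) (z : Fin n → Z) (f : Z → ℝ) :
    empSD z f ^ 2 = empMean z (fun x => f x ^ 2) - empMean z f ^ 2 := by
  rw [empSD, Real.sq_sqrt]
  have h := empMean_sub_sq hn z f (empMean z f)
  have h0 := empMean_nonneg z (f := fun x => (f x - empMean z f) ^ 2) fun x => sq_nonneg _
  linarith

/-- Decomposition of the empirical second moment about a point. -/
theorem empMean_sub_sq_eq {n : ℕ} (hn : 0 < n) (z : Fin n → Z) (f : Z → ℝ) (a : ℝ) :
    empMean z (fun x => (f x - a) ^ 2) = empSD z f ^ 2 + (empMean z f - a) ^ 2 := by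
  rw [empMean_sub_sq hn, empSD_sq hn]
  ring

theorem empSD_nonneg {n : ℕ} (z : Fin n → Z) (f : Z → ℝ) : 0 ≤ empSD z f :=
  Real.sqrt_nonneg _

theorem empSD_neg {n : ℕ} (z : Fin n → Z) (f : Z → ℝ) : empSD z (fun x => -f x) = empSD z f := by
  simp [empSD, empMean, Finset.sum_neg_distrib, neg_div]

theorem empMean_neg {n : ℕ} (z : Fin n → Z) (f : Z → ℝ) :
    empMean z (fun x => -f x) = -empMean z f := by
  simp [empMean, Finset.sum_neg_distrib, neg_div]

theorem empSD_le {n : ℕ} (hn : 0 < n) (z : Fin n → Z) {f : Z → ℝ} {B : ℝ} (hB : 0 ≤ B)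
    (hf : ∀ x, |f x| ≤ B) : empSD z f ≤ B := by
  refine abs_le_of_sq_le_sq' ?_ hB |>.2
  have h : empMean z (fun x => f x ^ 2) ≤ empMean z fun _ => B ^ 2 :=
    empMean_mono z fun j => sq_le_sq' (abs_le.1 (hf _)).1 (abs_le.1 (hf _)).2
  have h' : empMean z (fun _ => B ^ 2) = B ^ 2 := by
    have hn' : (n : ℝ) ≠ 0 := by positivity
    simp [empMean, hn']
  rw [empSD_sq hn]
  linarith [sq_nonneg (empMean z f)]

section Measure

variable [MeasurableSpace Z] (μ : Measure Z) [IsProbabilityMeasure μ]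

theorem integral_empMean {n : ℕ} (hn : 0 < n) {f : Z → ℝ} (hf : Integrable f μ) :
    Integrable (fun z => empMean z f) (Measure.pi fun _ : Fin n => μ) ∧
      ∫ z, empMean z f ∂(Measure.pi fun _ : Fin n => μ) = ∫ x, f x ∂μ := by
  have hint : ∀ j : Fin n, Integrable (fun z : Fin n → Z => f (z j)) (Measure.pi fun _ => μ) :=
    fun j => (measurePreserving_eval (fun _ : Fin n => μ) j).integrable_comp_of_integrable hf
  refine ⟨(integrable_finsetSum _ fun j _ => hint j).div_const _, ?_⟩
  have hn' : (n : ℝ) ≠ 0 := by positivity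
  have heval : ∀ j : Fin n, ∫ z : Fin n → Z, f (z j) ∂(Measure.pi fun _ => μ) = ∫ x, f x ∂μ := by
    intro j
    have hmp := measurePreserving_eval (fun _ : Fin n => μ) j
    have hf' : AEStronglyMeasurable f
        ((Measure.pi fun _ : Fin n => μ).map (Function.eval j)) := by
      rw [hmp.map_eq]; exact hf.aestronglyMeasurable
    rw [← integral_map hmp.measurable.aemeasurable hf', hmp.map_eq]
  simp only [empMean]
  rw [integral_div, integral_finsetSum _ fun j _ => hint j]
  simp [heval, hn']

/-- Chebyshev's inequality for the empirical mean. -/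
theorem pi_sq_empMean_sub_ge_le {n : ℕ} (hn : 0 < n) {f : Z → ℝ} (hf : MemLp f 2 μ) {s : ℝ}
    (hs : 0 < s) (hvar : Var[f; μ] ≤ s) :
    (Measure.pi fun _ : Fin n => μ) {z | 4 * s ≤ n * (empMean z f - ∫ x, f x ∂μ) ^ 2} ≤ 4⁻¹ := by
  have hn' : (0 : ℝ) < n := by positivity
  have hmp : ∀ j : Fin n, MemLp (fun z : Fin n → Z => f (z j)) 2 (Measure.pi fun _ => μ) :=
    fun j => hf.comp_measurePreserving (measurePreserving_eval (fun _ : Fin n => μ) j)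
  set X : (Fin n → Z) → ℝ := ∑ j, fun z => f (z j) with hX
  have hXm : MemLp X 2 (Measure.pi fun _ : Fin n => μ) := memLp_finsetSum' _ fun j _ => hmp j
  have hXe : ∀ z, X z = n * empMean z f := fun z => by
    rw [← sum_eq_mul_empMean hn]
    simp [hX]
  have hEX : ∫ z, X z ∂(Measure.pi fun _ : Fin n => μ) = n * ∫ x, f x ∂μ := by
    simp only [hXe]
    rw [integral_const_mul, (integral_empMean μ hn (hf.integrable (by norm_num))).2]
  have hVX : Var[X; Measure.pi fun _ : Fin n => μ] = n * Var[f; μ] := by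
    rw [hX, variance_sum_pi (X := fun _ : Fin n => f) fun _ => hf]
    simp
  have hc : 0 < √(4 * s * n) := by positivity
  have hcheb := meas_ge_le_variance_div_sq hXm hc
  rw [hVX, Real.sq_sqrt (by positivity)] at hcheb
  refine (measure_mono fun z hz => ?_).trans (hcheb.trans ?_)
  · have hz' : 4 * s ≤ n * (empMean z f - ∫ x, f x ∂μ) ^ 2 := hz
    change √(4 * s * n) ≤ |X z - ∫ z, X z ∂(Measure.pi fun _ : Fin n => μ)|
    rw [hEX, hXe, ← mul_sub]
    refine Real.sqrt_le_iff.2 ⟨abs_nonneg _, ?_⟩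
    rw [sq_abs]
    calc 4 * s * n ≤ n * (empMean z f - ∫ x, f x ∂μ) ^ 2 * n := by gcongr
      _ = _ := by ring
  · rw [show (4⁻¹ : ℝ≥0∞) = ENNReal.ofReal 4⁻¹ by
      rw [ENNReal.ofReal_inv_of_pos (by norm_num)]; norm_num]
    refine ENNReal.ofReal_le_ofReal ?_
    rw [div_le_iff₀ (by positivity)]
    nlinarith

/-- Markov's inequality for the empirical mean. -/
theorem pi_empMean_ge_le {n : ℕ} (hn : 0 < n) {f : Z → ℝ} (hf : Integrable f μ)
    (h0 : ∀ x, 0 ≤ f x) {s : ℝ} (hs : 0 < s) (hE : ∫ x, f x ∂μ ≤ s) :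
    (Measure.pi fun _ : Fin n => μ) {z | 4 * s ≤ empMean z f} ≤ 4⁻¹ := by
  have h := integral_empMean μ hn hf
  have hm := mul_meas_ge_le_integral_of_nonneg (μ := Measure.pi fun _ : Fin n => μ)
    (ae_of_all _ fun z => empMean_nonneg z h0) h.1 (4 * s)
  rw [h.2] at hm
  have hr : (Measure.pi fun _ : Fin n => μ).real {z | 4 * s ≤ empMean z f} ≤ 4⁻¹ := by
    by_contra! hcon
    nlinarith
  rw [show (4⁻¹ : ℝ≥0∞) = ENNReal.ofReal 4⁻¹ by
    rw [ENNReal.ofReal_inv_of_pos (by norm_num)]; norm_num]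
  rw [← ofReal_measureReal]
  exact ENNReal.ofReal_le_ofReal hr

/-- With probability at least one half, a sample has both its mean and its dispersion under
control. -/
theorem half_le_pi_empMean {n : ℕ} (hn : 0 < n) {f : Z → ℝ} (hf : MemLp f 2 μ) {s : ℝ}
    (hs : 0 < s) (hvar : Var[f; μ] ≤ s) :
    2⁻¹ ≤ (Measure.pi fun _ : Fin n => μ) {z | n * (empMean z f - ∫ x, f x ∂μ) ^ 2 < 4 * s ∧
      empMean z (fun x => (f x - ∫ y, f y ∂μ) ^ 2) < 4 * s} := by
  set G := {z : Fin n → Z | n * (empMean z f - ∫ x, f x ∂μ) ^ 2 < 4 * s ∧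
      empMean z (fun x => (f x - ∫ y, f y ∂μ) ^ 2) < 4 * s}
  have h1 := pi_sq_empMean_sub_ge_le μ hn hf hs hvar
  have h2 := pi_empMean_ge_le μ hn (f := fun x => (f x - ∫ y, f y ∂μ) ^ 2)
    (hf.sub (memLp_const _)).integrable_sq (fun x => sq_nonneg _) hs
    (by rwa [← variance_eq_integral hf.aestronglyMeasurable.aemeasurable])
  have hcompl : (Measure.pi fun _ : Fin n => μ) Gᶜ ≤ 2⁻¹ := by
    have hsub : Gᶜ ⊆ {z | 4 * s ≤ n * (empMean z f - ∫ x, f x ∂μ) ^ 2} ∪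
        {z | 4 * s ≤ empMean z (fun x => (f x - ∫ y, f y ∂μ) ^ 2)} := by
      intro z hz
      by_contra hcon
      simp only [mem_union, mem_ofPred_eq, not_or, not_le] at hcon
      exact hz hcon
    refine (measure_mono hsub).trans ((measure_union_le _ _).trans ((add_le_add h1 h2).trans ?_))
    have h4 : (4⁻¹ : ℝ≥0∞) = 2⁻¹ / 2 := by
      rw [div_eq_mul_inv, ← ENNReal.mul_inv (by norm_num) (by norm_num)]
      norm_num
    rw [h4, ENNReal.add_halves]
  have huniv : 1 ≤ (Measure.pi fun _ : Fin n => μ) G + (Measure.pi fun _ : Fin n => μ) Gᶜ := by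
    rw [← measure_univ (μ := Measure.pi fun _ : Fin n => μ), ← union_compl_self G]
    exact measure_union_le _ _
  rw [← ENNReal.inv_two_add_inv_two] at huniv
  have := huniv.trans (add_le_add_right hcompl _)
  exact (ENNReal.add_le_add_iff_right (by norm_num)).1 this

end Measure

theorem discrepant_of_lt {c : ℝ} {n : ℕ} (hn : 0 < n) {z z' : Fin n → Z} {f : Z → ℝ} {v : ℝ}
    (hc : 0 ≤ c) (hm : empMean z f ≤ empMean z' f)
    (hv : ∑ j, (f (z' j) - f (z j)) ^ 2 ≤ n * v)
    (h : c * (Real.log n / n) * (v + Real.log n / n) < (empMean z' f - empMean z f) ^ 2) :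
    Discrepant c (z, z') f := by
  have hn' : (0 : ℝ) < n := by positivity
  have hlog : 0 ≤ Real.log n := Real.log_natCast_nonneg n
  rw [Discrepant, Finset.sum_sub_distrib, sum_eq_mul_empMean hn, sum_eq_mul_empMean hn, ← mul_sub]
  rcases (sub_nonneg.2 hm).eq_or_lt with h0 | hpos
  · rw [← h0] at h
    exfalso
    have hv0 : 0 ≤ v := by
      have : 0 ≤ n * v := (Finset.sum_nonneg fun j _ => sq_nonneg _).trans hv
      exact nonneg_of_mul_nonneg_right this hn'
    have : 0 ≤ c * (Real.log n / n) * (v + Real.log n / n) := by positivity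
    norm_num at h
    linarith
  rw [Real.sqrt_lt' (by positivity)]
  calc c * Real.log n * (∑ j, (f (z' j) - f (z j)) ^ 2 + Real.log n)
      ≤ c * Real.log n * (n * v + Real.log n) := by gcongr
    _ = n ^ 2 * (c * (Real.log n / n) * (v + Real.log n / n)) := by field_simp
    _ < n ^ 2 * (empMean z' f - empMean z f) ^ 2 := by gcongr
    _ = _ := by ring

theorem discrepancy_of_mean_gt {b c L H M M' : ℝ} (hb : 1 ≤ b) (hc : 1 ≤ c) (hL : 0 < L)
    (hM : 0 ≤ M) (hH : 2 * M + 64 * b * c * L < H) (hM' : (M' - H) ^ 2 < 4 * (b * H) * L) :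
    M ≤ M' ∧ c * L * (b * (M' + M) + L) < (M' - M) ^ 2 := by
  have hbc : b * L ≤ b * c * L := by nlinarith [mul_nonneg (by linarith : (0:ℝ) ≤ b) hL.le]
  have hLb : L ≤ b * L := by nlinarith
  have hHp : 0 < H := by nlinarith
  have h1 : (M' - H) ^ 2 < (H / 4) ^ 2 := by nlinarith
  have h2 := abs_lt.1 (abs_lt_of_sq_lt_sq h1 (by linarith))
  have hD : H / 4 < M' - M := by nlinarith
  refine ⟨by linarith, ?_⟩
  have hV : b * (M' + M) + L ≤ b * (11 / 4 * H) := by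
    have : M' + M ≤ 7 / 4 * H := by nlinarith
    nlinarith
  calc c * L * (b * (M' + M) + L) ≤ c * L * (b * (11 / 4 * H)) := by gcongr
    _ = 11 / 4 * H * (b * c * L) := by ring
    _ ≤ 11 / 4 * H * (H / 64) := by gcongr; nlinarith
    _ ≤ (H / 4) ^ 2 := by nlinarith
    _ < (M' - M) ^ 2 := by gcongr

theorem discrepancy_of_ratio_gt {c C₂ L w E M M' S v P : ℝ} (hc : 1 ≤ c) (hC₂ : 1 ≤ C₂)
    (hL : 0 < L) (hLc : 288 * c * L ≤ 1) (hSw : S ≤ w) (hLw : L ≤ w) (hME : M < E)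
    (hw : (16 * c * (8 * C₂ + 27)) ^ 2 * L * w < (E - M) ^ 2)
    (hv : v ≤ 2 * (S + (M - E) ^ 2) + C₂ * L) (hM' : (M' - E) ^ 2 < 4 * (v + L) * L)
    (hP : P < 4 * (v + L)) :
    M ≤ M' ∧ c * L * (2 * P + 2 * (S + (M - E) ^ 2) + L) < (M' - M) ^ 2 := by
  set C := 16 * c * (8 * C₂ + 27) with hC
  set Δ := E - M with hΔ
  have hΔ2 : (M - E) ^ 2 = Δ ^ 2 := by rw [hΔ]; ring
  rw [hΔ2] at hv ⊢
  have hΔp : 0 < Δ := sub_pos.2 hME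
  have hw0 : 0 < w := hL.trans_le hLw
  have hLw0 : 0 < L * w := mul_pos hL hw0
  have hC1 : 128 * (C₂ + 3) ≤ C := by nlinarith
  have hCC : C ≤ C ^ 2 := by nlinarith
  have hCLw : C * (L * w) ≤ Δ ^ 2 := by nlinarith
  have hs : v + L ≤ (C₂ + 3) * w + 2 * Δ ^ 2 := by nlinarith
  have hLΔ : c * L * Δ ^ 2 ≤ Δ ^ 2 / 288 := by nlinarith [sq_nonneg Δ]
  have hLΔ' : L * Δ ^ 2 ≤ c * L * Δ ^ 2 := by nlinarith [mul_nonneg hL.le (sq_nonneg Δ)]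
  have h1 : (M' - E) ^ 2 < (Δ / 2) ^ 2 := by
    calc (M' - E) ^ 2 < 4 * (v + L) * L := hM'
      _ ≤ 4 * ((C₂ + 3) * w + 2 * Δ ^ 2) * L := by gcongr
      _ = 128 * (C₂ + 3) * (L * w) / 32 + 8 * (L * Δ ^ 2) := by ring
      _ ≤ C * (L * w) / 32 + 8 * (L * Δ ^ 2) := by gcongr
      _ ≤ (Δ / 2) ^ 2 := by nlinarith
  have h2 := abs_lt.1 (abs_lt_of_sq_lt_sq h1 (by linarith))
  have hD : Δ / 2 < M' - M := by linarith
  refine ⟨by linarith, ?_⟩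
  have hcL : 0 ≤ c * L := by positivity
  calc c * L * (2 * P + 2 * (S + Δ ^ 2) + L)
      ≤ c * L * ((8 * C₂ + 27) * w + 18 * Δ ^ 2) := by
        refine mul_le_mul_of_nonneg_left ?_ hcL
        nlinarith
    _ = C * (L * w) / 16 + 18 * (c * L * Δ ^ 2) := by rw [hC]; ring
    _ ≤ (Δ / 2) ^ 2 := by nlinarith
    _ < (M' - M) ^ 2 := by gcongr

theorem EmpiricalCovering.comp_lipschitz {F : I → Z → ℝ} {A V K : ℝ}
    (hF : EmpiricalCovering F A V) (hK : 1 ≤ K) {ψ : ℝ → ℝ}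
    (hψ : ∀ u v, |ψ u - ψ v| ≤ K * |u - v|) :
    EmpiricalCovering (fun i z => ψ (F i z)) (A * K ^ V) V := by
  intro ε hε hε1 ι _ _ x
  have hK0 : 0 < K := by linarith
  obtain ⟨k, φ, hk, hφ⟩ := hF (ε / K) (by positivity)
    ((div_le_self hε.le hK).trans_lt hε1) ι x
  refine ⟨k, fun l j => ψ (φ l j), hk.trans_eq ?_, fun i => ?_⟩
  · rw [Real.div_rpow hε.le hK0.le, Real.rpow_neg hK0.le]
    field_simp
  · obtain ⟨l, hl⟩ := hφ i
    refine ⟨l, ?_⟩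
    calc ∑ j, |ψ (F i (x j)) - ψ (φ l j)| ≤ ∑ j, K * |F i (x j) - φ l j| :=
          Finset.sum_le_sum fun j _ => hψ _ _
      _ = K * ∑ j, |F i (x j) - φ l j| := by rw [Finset.mul_sum]
      _ ≤ K * (Fintype.card ι * (ε / K)) := by gcongr
      _ = Fintype.card ι * ε := by field_simp

variable [MeasurableSpace Z] [StandardBorelSpace Z] {I : Type*} [MeasurableSpace I]
  [StandardBorelSpace I]

theorem one_le_log_natCast {n : ℕ} (hn : 3 ≤ n) : 1 ≤ Real.log n := by
  have : (3 : ℝ) ≤ n := by exact_mod_cast hn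
  rw [Real.le_log_iff_exp_le (by positivity)]
  linarith [Real.exp_one_lt_d9]

/-- The relative deviation inequality for bounded nonnegative functions. -/
theorem pi_integral_gt_two_mul_le (μ : Measure Z) [IsProbabilityMeasure μ] {h : I → Z → ℝ}
    (hm : Measurable (Function.uncurry h)) {A V b : ℝ} (hA : 0 < A) (hV : 0 < V) (hb : 1 ≤ b)
    (hcov : EmpiricalCovering h A V) (h0 : ∀ i z, 0 ≤ h i z) (hhb : ∀ i z, h i z ≤ b) {n : ℕ}
    (hn : 3 ≤ n) :
    (Measure.pi fun _ : Fin n => μ) {z | ∃ i,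
        2 * empMean z (h i) + 64 * b * (16 * (V + 1)) * (Real.log n / n) < ∫ x, h i x ∂μ}
      ≤ 2 * ENNReal.ofReal (A * (8 * b) ^ V / n) := by
  have hn0 : 0 < n := by omega
  have hn' : (0 : ℝ) < n := by positivity
  have hlog := one_le_log_natCast hn
  have habs : ∀ i z, |h i z| ≤ b := fun i z =>
    abs_le.2 ⟨by linarith [h0 i z], hhb i z⟩
  have hmi : ∀ i, Measurable (h i) := fun i => hm.comp measurable_prodMk_left
  refine (measure_le_two_mul_prod fun z hz => ?_).trans
    (mul_le_mul_right (prod_discrepant_le μ hm hA hV hb hcov habs hn) 2)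
  obtain ⟨i, hi⟩ := hz
  set H := ∫ x, h i x ∂μ with hH
  have hM0 := empMean_nonneg z (h0 i)
  have hHp : 0 < H := by
    have : 0 ≤ 64 * b * (16 * (V + 1)) * (Real.log n / n) := by positivity
    linarith
  have hL2 : MemLp (h i) 2 μ := MemLp.of_bound (hmi i).aestronglyMeasurable b (ae_of_all _ (habs i))
  have hvar : Var[h i; μ] ≤ b * H := by
    refine (variance_le_expectation_sq (hmi i).aestronglyMeasurable).trans ?_
    rw [hH, ← integral_const_mul]
    refine integral_mono hL2.integrable_sq ((hL2.integrable (by norm_num)).const_mul b) fun x => ?_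
    have := mul_le_mul_of_nonneg_right (hhb i x) (h0 i x)
    simpa [sq] using this
  refine (half_le_pi_empMean μ hn0 hL2 (by positivity : 0 < b * H) hvar).trans
    (measure_mono fun z' hz' => ⟨i, ?_⟩)
  have hcheb : (empMean z' (h i) - H) ^ 2 < 4 * (b * H) * (Real.log n / n) := by
    have h1 : (empMean z' (h i) - H) ^ 2 < 4 * (b * H) / n := by
      rw [lt_div_iff₀ hn', mul_comm]
      exact hz'.1
    refine h1.trans_le ?_
    rw [← mul_div_assoc]
    exact div_le_div_of_nonneg_right (le_mul_of_one_le_right (by positivity) hlog) hn'.le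
  obtain ⟨hle, hlt⟩ := discrepancy_of_mean_gt hb (by linarith : 1 ≤ 16 * (V + 1))
    (by positivity : 0 < Real.log n / n) hM0 hi hcheb
  refine discrepant_of_lt hn0 (by positivity) hle ?_ hlt
  calc ∑ j, (h i (z' j) - h i (z j)) ^ 2
      ≤ ∑ j, b * (h i (z' j) + h i (z j)) := by
        refine Finset.sum_le_sum fun j _ => ?_
        nlinarith [h0 i (z' j), h0 i (z j), hhb i (z' j), hhb i (z j),
          mul_nonneg (h0 i (z' j)) (h0 i (z j)),
          mul_nonneg (h0 i (z' j)) (sub_nonneg.2 (hhb i (z' j))),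
          mul_nonneg (h0 i (z j)) (sub_nonneg.2 (hhb i (z j)))]
    _ = n * (b * (empMean z' (h i) + empMean z (h i))) := by
        rw [← Finset.mul_sum, Finset.sum_add_distrib, sum_eq_mul_empMean hn0,
          sum_eq_mul_empMean hn0]
        ring

/-- The constant in the relative deviation inequality for the squares of functions bounded by
`Y`. -/
def squareConst (V Y : ℝ) : ℝ := 64 * (4 * Y ^ 2) * (16 * (V + 1))

/-- The constant in the studentized deviation inequality for functions bounded by `Y`. -/
def ratioConst (V Y : ℝ) : ℝ := 16 * (16 * (V + 1)) * (8 * squareConst V Y + 27)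

/-- The studentized deviation inequality: uniformly over a class with polynomial covering
numbers, the empirical mean falls below the mean by at most a multiple of `√(log n / n)` times
the truncated empirical standard deviation. The multiple does not depend on the bound `B` that
holds everywhere, but only on the bound `Y` that holds almost surely. -/
theorem pi_integral_sub_empMean_gt_le (μ : Measure Z) [IsProbabilityMeasure μ] {F : I → Z → ℝ}
    (hm : Measurable (Function.uncurry F)) {A V B Y : ℝ} (hA : 0 < A) (hV : 0 < V) (hB : 1 ≤ B)
    (hY : 1 ≤ Y)
    (hcov : ∀ t : I → ℝ, (∀ i, |t i| ≤ Y) → EmpiricalCovering (fun i z => F i z + t i) A V)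
    (hFB : ∀ i z, |F i z| ≤ B) (hFY : ∀ i, ∀ᵐ z ∂μ, |F i z| ≤ Y) {n : ℕ} (hn : 3 ≤ n)
    (hnV : 288 * (16 * (V + 1)) * (Real.log n / n) ≤ 1) :
    (Measure.pi fun _ : Fin n => μ) {z | ∃ i,
        ratioConst V Y * √(Real.log n / n) * max (empSD z (F i)) √(Real.log n / n)
          < ∫ x, F i x ∂μ - empMean z (F i)}
      ≤ 2 * ENNReal.ofReal (A * (4 * Y) ^ V * (8 * (4 * Y ^ 2)) ^ V / n)
        + 2 * ENNReal.ofReal (A * (8 * B) ^ V / n) := by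
  have hn0 : 0 < n := by omega
  have hn' : (0 : ℝ) < n := by positivity
  have hlog := one_le_log_natCast hn
  have hmi : ∀ i, Measurable (F i) := fun i => hm.comp measurable_prodMk_left
  have hY0 : 0 ≤ Y := by linarith
  set m : I → ℝ := fun i => ∫ x, F i x ∂μ with hmdef
  have hmm : Measurable m := (hm.stronglyMeasurable.integral_prod_right (ν := μ)).measurable
  have hmY : ∀ i, |m i| ≤ Y := fun i => by
    have := norm_integral_le_of_norm_le_const (μ := μ) (f := F i) (C := Y) (hFY i)
    simpa using this
  let h : I → Z → ℝ := fun i z => clip (2 * Y) (F i z + -m i) ^ 2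
  have hhm : Measurable (Function.uncurry h) := by
    have : Measurable fun p : I × Z => F p.1 p.2 + -m p.1 :=
      hm.add (hmm.comp measurable_fst).neg
    exact ((measurable_const.max (measurable_const.min this))).pow_const 2
  have hhcov : EmpiricalCovering h (A * (4 * Y) ^ V) V := by
    refine (hcov (fun i => -m i) fun i => by simpa using hmY i).comp_lipschitz (K := 4 * Y)
      (ψ := fun u => clip (2 * Y) u ^ 2) (by linarith) fun u v => ?_
    have h1 := abs_clip_sub_clip_le (2 * Y) u v
    have h2 : |clip (2 * Y) u + clip (2 * Y) v| ≤ 4 * Y := by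
      linarith [abs_add_le (clip (2 * Y) u) (clip (2 * Y) v),
        abs_clip_le (by linarith : 0 ≤ 2 * Y) u, abs_clip_le (by linarith : 0 ≤ 2 * Y) v]
    rw [sq_sub_sq, abs_mul]
    gcongr
  have hh0 : ∀ i z, 0 ≤ h i z := fun i z => sq_nonneg _
  have hhb : ∀ i z, h i z ≤ 4 * Y ^ 2 := fun i z => by
    have h1 := abs_clip_le (by linarith : 0 ≤ 2 * Y) (F i z + -m i)
    calc h i z = |clip (2 * Y) (F i z + -m i)| ^ 2 := (sq_abs _).symm
      _ ≤ (2 * Y) ^ 2 := by gcongr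
      _ = 4 * Y ^ 2 := by ring
  have hhsq : ∀ i z, h i z ≤ (F i z - m i) ^ 2 := fun i z => by
    have h1 := abs_clip_sub_clip_le (2 * Y) (F i z + -m i) 0
    have h2 : clip (2 * Y) 0 = 0 := clip_of_abs_le (by simpa using by linarith)
    rw [h2, sub_zero, sub_zero, ← sub_eq_add_neg] at h1
    exact sq_le_sq.2 (by simpa only [← sub_eq_add_neg] using h1)
  have hL2 : ∀ i, MemLp (F i) 2 μ := fun i =>
    MemLp.of_bound (hmi i).aestronglyMeasurable B (ae_of_all _ (hFB i))
  have hhE : ∀ i, ∫ x, h i x ∂μ = Var[F i; μ] := fun i => by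
    rw [variance_eq_integral (hmi i).aemeasurable]
    refine integral_congr_ae ?_
    filter_upwards [hFY i] with x hx
    have : |F i x + -m i| ≤ 2 * Y := by
      have := abs_add_le (F i x) (-m i)
      rw [abs_neg] at this
      linarith [hmY i]
    change clip (2 * Y) (F i x + -m i) ^ 2 = (F i x - m i) ^ 2
    rw [clip_of_abs_le this, sub_eq_add_neg]
  have hbad := pi_integral_gt_two_mul_le μ hhm (by positivity) hV (by nlinarith) hhcov hh0 hhb hn
  rw [← show squareConst V Y = 64 * (4 * Y ^ 2) * (16 * (V + 1)) from rfl] at hbad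
  have hsplit : {z : Fin n → Z | ∃ i,
        ratioConst V Y * √(Real.log n / n) * max (empSD z (F i)) √(Real.log n / n)
          < ∫ x, F i x ∂μ - empMean z (F i)} ⊆
      {z | ∃ i, 2 * empMean z (h i) + squareConst V Y * (Real.log n / n) < ∫ x, h i x ∂μ} ∪
      {z | (∃ i, ratioConst V Y * √(Real.log n / n) * max (empSD z (F i)) √(Real.log n / n)
          < m i - empMean z (F i)) ∧
        ∀ i, ∫ x, h i x ∂μ ≤ 2 * empMean z (h i) + squareConst V Y * (Real.log n / n)} := by
    intro z hz
    by_cases hz' : ∃ i, 2 * empMean z (h i) + squareConst V Y * (Real.log n / n) < ∫ x, h i x ∂μ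
    · exact Or.inl hz'
    · exact Or.inr ⟨hz, by simpa using hz'⟩
  refine (measure_mono hsplit).trans ((measure_union_le _ _).trans (add_le_add hbad ?_))
  refine (measure_le_two_mul_prod fun z hz => ?_).trans
    (mul_le_mul_right (prod_discrepant_le μ hm hA hV hB
      (by simpa using hcov (fun _ => 0) fun _ => by simpa using hY0) hFB hn) 2)
  obtain ⟨⟨i, hi⟩, hgood⟩ := hz
  have hvi := hgood i
  rw [hhE] at hvi
  set L := Real.log n / n with hLdef
  have hL : 0 < L := by positivity
  have hC2 : 1 ≤ squareConst V Y := by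
    rw [squareConst]
    nlinarith [mul_pos hV (by positivity : 0 < Y ^ 2)]
  have hCp : 0 < ratioConst V Y := by rw [ratioConst]; positivity
  set w := max (empSD z (F i)) √L ^ 2 with hw
  have hSw : empSD z (F i) ^ 2 ≤ w := by
    have := empSD_nonneg z (F i)
    rw [hw]
    gcongr
    exact le_max_left _ _
  have hLw : L ≤ w := by
    rw [← Real.sq_sqrt hL.le, hw]
    gcongr
    exact le_max_right _ _
  have hpos : 0 ≤ ratioConst V Y * √L * max (empSD z (F i)) √L := by
    have : 0 ≤ max (empSD z (F i)) √L := le_max_of_le_right (Real.sqrt_nonneg _)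
    positivity
  have hME : empMean z (F i) < m i := by linarith
  have hwlt : ratioConst V Y ^ 2 * L * w < (m i - empMean z (F i)) ^ 2 := by
    calc ratioConst V Y ^ 2 * L * w
        = (ratioConst V Y * √L * max (empSD z (F i)) √L) ^ 2 := by
          rw [mul_pow, mul_pow, Real.sq_sqrt hL.le]
      _ < _ := by gcongr
  have hv : Var[F i; μ] ≤ 2 * (empSD z (F i) ^ 2 + (empMean z (F i) - m i) ^ 2)
      + squareConst V Y * L := by
    rw [← empMean_sub_sq_eq hn0]
    have := empMean_mono z (f := h i) (g := fun x => (F i x - m i) ^ 2) fun j => hhsq i (z j)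
    linarith
  have hvar0 : 0 ≤ Var[F i; μ] := variance_nonneg _ _
  refine (half_le_pi_empMean μ hn0 (hL2 i) (by positivity : 0 < Var[F i; μ] + L)
    (by linarith)).trans (measure_mono fun z' hz' => ⟨i, ?_⟩)
  obtain ⟨hz1, hz2⟩ := hz'
  have hcheb : (empMean z' (F i) - m i) ^ 2 < 4 * (Var[F i; μ] + L) * L := by
    have h1 : (empMean z' (F i) - m i) ^ 2 < 4 * (Var[F i; μ] + L) / n := by
      rw [lt_div_iff₀ hn', mul_comm]
      exact hz1
    refine h1.trans_le ?_
    rw [show 4 * (Var[F i; μ] + L) * L = 4 * (Var[F i; μ] + L) * Real.log n / n by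
      rw [hLdef, mul_div_assoc]]
    exact div_le_div_of_nonneg_right (le_mul_of_one_le_right (by positivity) hlog) hn'.le
  obtain ⟨hle, hlt⟩ := discrepancy_of_ratio_gt (by linarith : 1 ≤ 16 * (V + 1)) hC2 hL hnV hSw hLw
    hME hwlt hv hcheb hz2
  refine discrepant_of_lt hn0 (by positivity) hle ?_ hlt
  rw [← empMean_sub_sq_eq hn0, mul_add, mul_left_comm, mul_left_comm (n : ℝ),
    ← sum_eq_mul_empMean hn0 z' fun x => (F i x - ∫ y, F i y ∂μ) ^ 2,
    ← sum_eq_mul_empMean hn0 z fun x => (F i x - m i) ^ 2, Finset.mul_sum, Finset.mul_sum,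
    ← Finset.sum_add_distrib]
  refine Finset.sum_le_sum fun j _ => ?_
  have : (F i (z' j) - F i (z j)) ^ 2
      = ((F i (z' j) - m i) - (F i (z j) - m i)) ^ 2 := by ring
  rw [this]
  nlinarith [sq_nonneg ((F i (z' j) - m i) + (F i (z j) - m i))]

end Deviation

/-! ### Covering numbers at empirical measures -/

section Covering

variable {Z : Type*} [MeasurableSpace Z]

theorem exists_cover_of_coveringNumber_le {ε x : ℝ} {F : Set (Z → ℝ)} {Q : Measure Z}
    (hx : 0 ≤ x) (h : (coveringNumber ε F Q : ℝ≥0∞) ≤ ENNReal.ofReal x) :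
    ∃ (k : ℕ) (φ : Fin k → Z → ℝ), (k : ℝ) ≤ x ∧
      ∀ f ∈ F, ∃ i, eLpNorm (f - φ i) 1 Q ≤ ENNReal.ofReal ε := by
  set S := {N : ℕ∞ | ∃ (k : ℕ) (φ : Fin k → Z → ℝ), N = k ∧ (∀ i, Integrable (φ i) Q) ∧
    ∀ f ∈ F, ∃ i, eLpNorm (f - φ i) 1 Q ≤ ENNReal.ofReal ε} with hS
  have hne : S.Nonempty := by
    by_contra hcon
    have htop : coveringNumber ε F Q = ⊤ := by
      change sInf S = ⊤
      rw [Set.not_nonempty_iff_eq_empty.1 hcon, sInf_empty]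
    rw [htop] at h
    exact absurd h (by simp)
  obtain ⟨k, φ, hk, -, hφ⟩ := csInf_mem hne
  refine ⟨k, φ, ?_, hφ⟩
  have hk' : coveringNumber ε F Q = k := hk
  rw [hk', ENat.toENNReal_coe, ← ENNReal.ofReal_natCast] at h
  exact (ENNReal.ofReal_le_ofReal_iff hx).1 h

theorem PolynomialCovering.empiricalCovering [MeasurableSingletonClass Z] {I : Type*}
    {F : I → Z → ℝ} {C : Set (Z → ℝ)} {A V : ℝ} (hA : 0 ≤ A) (hC : PolynomialCovering C A V)
    (hF : ∀ i, F i ∈ C) : EmpiricalCovering F A V := by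
  intro ε hε hε1 ι _ _ x
  have hN : (Fintype.card ι : ℝ≥0∞) ≠ 0 := by simp
  have hN' : (Fintype.card ι : ℝ≥0∞) ≠ ∞ := ENNReal.natCast_ne_top _
  set Q : Measure Z := (Fintype.card ι : ℝ≥0∞)⁻¹ • ∑ j, Measure.dirac (x j) with hQ
  have hprob : IsProbabilityMeasure Q := ⟨by
    simp [hQ, ENNReal.inv_mul_cancel hN hN']⟩
  obtain ⟨k, φ, hk, hφ⟩ := exists_cover_of_coveringNumber_le (by positivity) (hC ε hε hε1 ⟨Q, hprob⟩)
  refine ⟨k, fun l j => φ l (x j), hk, fun i => ?_⟩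
  obtain ⟨l, hl⟩ := hφ (F i) (hF i)
  refine ⟨l, ?_⟩
  have hl' : eLpNorm (F i - φ l) 1 Q ≤ ENNReal.ofReal ε := hl
  rw [eLpNorm_one_eq_lintegral_enorm, hQ, lintegral_smul_measure,
    lintegral_finsetSum_measure] at hl'
  simp only [lintegral_dirac, smul_eq_mul, Pi.sub_apply, Real.enorm_eq_ofReal_abs] at hl'
  rw [← ENNReal.ofReal_sum_of_nonneg fun j _ => abs_nonneg _, mul_comm, ← div_eq_mul_inv,
    ENNReal.div_le_iff hN hN', ← ENNReal.ofReal_natCast, ← ENNReal.ofReal_mul hε.le,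
    ENNReal.ofReal_le_ofReal_iff (by positivity)] at hl'
  linarith

/-- A function all of whose multiples by factors in `[0, 1]` belong to a class with polynomial
covering numbers is bounded, by a constant that depends only on the covering numbers. -/
theorem abs_le_of_empiricalCovering {Z : Type*} {f : Z → ℝ} {A V : ℝ}
    (h : EmpiricalCovering (fun (s : Icc (0 : ℝ) 1) z => s * f z) A V) (z : Z) :
    |f z| ≤ A * 2 ^ V := by
  obtain ⟨k, φ, hk, hφ⟩ := h (1 / 2) (by norm_num) (by norm_num) Unit fun _ => z
  have hk' : (k : ℝ) ≤ A * 2 ^ V := by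
    refine hk.trans_eq ?_
    rw [one_div, Real.inv_rpow (by norm_num), Real.rpow_neg (by norm_num), inv_inv]
  refine le_trans ?_ hk'
  by_contra! hcon
  have hk0 : 0 < k := by
    obtain ⟨l, -⟩ := hφ ⟨0, by simp⟩
    exact l.pos
  have hkR : (0 : ℝ) < k := by exact_mod_cast hk0
  let s : Fin (k + 1) → Icc (0 : ℝ) 1 := fun j => ⟨(j : ℕ) / k, by positivity, by
    rw [div_le_one hkR]
    exact_mod_cast Nat.lt_succ_iff.1 j.2⟩
  choose l hl using fun j => hφ (s j)
  obtain ⟨j, j', hne, heq⟩ := Fintype.exists_ne_map_eq_of_card_lt l (by simp)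
  have h1 := hl j
  have h2 := hl j'
  rw [heq] at h1
  simp only [Fintype.card_unit, Finset.univ_unique, Finset.sum_singleton, Nat.cast_one,
    one_mul, s] at h1 h2
  have h3 : |((j : ℕ) / k - (j' : ℕ) / k : ℝ) * f z| ≤ 1 := by
    have := abs_sub_le ((j : ℕ) / k * f z : ℝ) (φ (l j') ()) ((j' : ℕ) / k * f z)
    rw [abs_sub_comm (φ (l j') ())] at this
    rw [sub_mul]
    refine this.trans ?_
    have h1' : |((j : ℕ) / k * f z : ℝ) - φ (l j') ()| ≤ 1 / 2 := h1
    have h2' : |((j' : ℕ) / k * f z : ℝ) - φ (l j') ()| ≤ 1 / 2 := h2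
    linarith
  have h4 : (1 : ℝ) ≤ |((j : ℕ) : ℝ) - ((j' : ℕ) : ℝ)| := by
    have : (1 : ℤ) ≤ |((j : ℕ) : ℤ) - ((j' : ℕ) : ℤ)| := by
      refine Int.one_le_abs (sub_ne_zero.2 ?_)
      exact_mod_cast fun h => hne (Fin.ext h)
    exact_mod_cast this
  rw [← sub_div, abs_mul, abs_div, abs_of_pos hkR, div_mul_eq_mul_div, div_le_one hkR] at h3
  nlinarith [abs_nonneg (f z)]

end Covering

/-! ### Uniformly negligible events -/

theorem UniformlyNegligible.of_eventually_le {Z : Type*} [MeasurableSpace Z]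
    {Ps : Set (ProbabilityMeasure Z)}
    {E E₁ E₂ : ProbabilityMeasure Z → (n : ℕ) → Set (Fin n → Z)} {u : ℕ → ℝ≥0∞}
    (hu : Tendsto u atTop (𝓝 0)) (h₁ : UniformlyNegligible Ps E₁)
    (h₂ : UniformlyNegligible Ps E₂)
    (h : ∀ᶠ n in atTop, ∀ P ∈ Ps, (Measure.pi fun _ : Fin n => (P : Measure Z)) (E P n)
      ≤ u n + (Measure.pi fun _ : Fin n => (P : Measure Z)) (E₁ P n)
        + (Measure.pi fun _ : Fin n => (P : Measure Z)) (E₂ P n)) :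
    UniformlyNegligible Ps E := by
  have hlim := (hu.add h₁).add h₂
  simp only [add_zero] at hlim
  refine tendsto_of_tendsto_of_tendsto_of_le_of_le' tendsto_const_nhds hlim
    (Eventually.of_forall fun _ => zero_le) ?_
  filter_upwards [h] with n hn
  refine iSup₂_le fun P hP => (hn P hP).trans ?_
  gcongr
  · exact le_iSup₂ (f := fun (P : ProbabilityMeasure Z) (_ : P ∈ Ps) => (Measure.pi fun _ : Fin n => (P : Measure Z)) (E₁ P n)) P hP
  · exact le_iSup₂ (f := fun (P : ProbabilityMeasure Z) (_ : P ∈ Ps) => (Measure.pi fun _ : Fin n => (P : Measure Z)) (E₂ P n)) P hP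

/-! ### Moments and the set estimate -/

theorem integral_mul_nonneg_of_condExp_nonneg {Ω : Type*} {m m₀ : MeasurableSpace Ω}
    {μ : Measure Ω} [IsFiniteMeasure μ] (hm : m ≤ m₀) {f g : Ω → ℝ}
    (hg : StronglyMeasurable[m] g) (hfg : Integrable (f * g) μ) (hf : Integrable f μ)
    (hf0 : 0 ≤ᵐ[μ] μ[f|m]) (hg0 : 0 ≤ᵐ[μ] g) : 0 ≤ ∫ x, (f * g) x ∂μ := by
  rw [← integral_condExp hm]
  refine integral_nonneg_of_ae ?_
  filter_upwards [condExp_mul_of_stronglyMeasurable_right hg hfg hf, hf0, hg0] with x h1 h2 h3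
  rw [h1]
  exact mul_nonneg h2 h3

namespace Model

variable {dX dW dY d : ℕ} {M : Model dX dW dY d}

theorem IsMeasurable.measurable_instrument (hM : M.IsMeasurable)
    {g : EuclideanSpace ℝ (Fin dX) → Fin dY → ℝ} (hg : g ∈ M.G) : Measurable g := by
  obtain ⟨-, -, T, _, _, γ, hγ, hG⟩ := hM
  rw [hG] at hg
  obtain ⟨t, rfl⟩ := hg
  exact hγ.comp measurable_prodMk_left

theorem IsMeasurable.measurable_moment (hM : M.IsMeasurable) {θ : EuclideanSpace ℝ (Fin d)}
    (hθ : θ ∈ M.Θ) {g : EuclideanSpace ℝ (Fin dX) → Fin dY → ℝ} (hg : g ∈ M.G) (j : Fin dY) :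
    Measurable (M.moment θ g j) := by
  have h1 : Measurable fun w => M.m w θ :=
    hM.2.1.comp (measurable_id.prodMk (measurable_const (a := (⟨θ, hθ⟩ : M.Θ))))
  exact (((measurable_pi_apply j).comp h1).comp measurable_snd).mul
    (((measurable_pi_apply j).comp (hM.measurable_instrument hg)).comp measurable_fst)

/-- Conditional moment inequalities imply the unconditional ones. -/
theorem integral_moment_nonneg (hM : M.IsMeasurable) (hG : M.InstrumentsNonneg) {Ybar : ℝ}
    (hb : M.BoundedMoments Ybar) {P : ProbabilityMeasure (Obs dX dW)} (hP : P ∈ M.P)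
    {θ : EuclideanSpace ℝ (Fin d)} (hθ : θ ∈ M.identifiedSet P)
    {g : EuclideanSpace ℝ (Fin dX) → Fin dY → ℝ} (hg : g ∈ M.G) (j : Fin dY) :
    0 ≤ ∫ z, M.moment θ g j z ∂(P : Measure (Obs dX dW)) := by
  have hint : Integrable (M.moment θ g j) (P : Measure (Obs dX dW)) :=
    Integrable.of_bound (hM.measurable_moment hθ.1 hg j).aestronglyMeasurable Ybar
      (hb P hP θ hθ.1 g hg j)
  exact integral_mul_nonneg_of_condExp_nonneg measurable_fst.comap_le
    (((measurable_pi_apply j).comp (hM.measurable_instrument hg)).comp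
      (comap_measurable Prod.fst)).stronglyMeasurable hint (hθ.2 j).1 (hθ.2 j).2 (hG P hP g hg j)

theorem mem_confRegion_of_empMean_ge {S : (Fin dY → ℝ) → ℝ≥0} {KS1 KS2 K C : ℝ}
    (hS : AggregatorCondition S KS1 KS2) (hKS1 : 0 < KS1) {n : ℕ} (hn : 3 ≤ n)
    {z : Fin n → Obs dX dW} {σ c : ℝ} {θ : EuclideanSpace ℝ (Fin d)} (hθ : θ ∈ M.Θ)
    (hK : 0 < K) (hCK : C < K * KS1) (hC : 0 ≤ C) (hKc : K ≤ c) (hσ : √(Real.log n / n) ≤ σ)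
    (h : ∀ g ∈ M.G, ∀ j, -(C * √(Real.log n / n) *
      max (empSD z (M.moment θ g j)) √(Real.log n / n)) ≤ empMean z (M.moment θ g j)) :
    θ ∈ M.confRegion S z σ c := by
  have hlog := one_le_log_natCast hn
  have hn' : (0 : ℝ) < n := by positivity
  have hL : 0 < √(Real.log n / n) := by positivity
  have hc : 0 < c := hK.trans_le hKc
  have hT : M.ksStat S z σ θ ≤ ENNReal.ofReal (c * √(Real.log n / n)) := by
    refine iSup₂_le fun g hg => ?_
    set t : Fin dY → ℝ := fun j => empMean z (M.moment θ g j) / max (empSD z (M.moment θ g j)) σ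
      with ht
    rw [← ENNReal.ofReal_coe_nnreal]
    refine ENNReal.ofReal_le_ofReal ?_
    by_contra! hcon
    obtain ⟨j, hj⟩ := (hS.2 (c * √(Real.log n / n)) (by positivity) t).1 hcon.le
    have hden : 0 < max (empSD z (M.moment θ g j)) σ := lt_max_of_lt_right (hL.trans_le hσ)
    have hlow : -(C * √(Real.log n / n)) ≤ t j := by
      rw [ht, le_div_iff₀ hden, neg_mul]
      refine le_trans (neg_le_neg ?_) (h g hg j)
      gcongr
    have : C * √(Real.log n / n) < K * KS1 * √(Real.log n / n) := by gcongr
    have : K * KS1 * √(Real.log n / n) ≤ c * KS1 * √(Real.log n / n) := by gcongr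
    linarith
  refine ⟨hθ, ?_⟩
  have hmul : ENNReal.ofReal (√(n : ℝ) / √(Real.log n)) * M.ksStat S z σ θ ≤ ENNReal.ofReal c := by
    calc _ ≤ ENNReal.ofReal (√(n : ℝ) / √(Real.log n))
          * ENNReal.ofReal (c * √(Real.log n / n)) := by gcongr
      _ = ENNReal.ofReal c := by
          rw [← ENNReal.ofReal_mul (by positivity), Real.sqrt_div' _ hn'.le]
          congr 1
          field_simp
  refine (EReal.coe_ennreal_le_coe_ennreal_iff.2 hmul).trans_eq ?_
  rw [EReal.coe_ennreal_ofReal, max_eq_left hc.le]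

theorem le_studentized_of_mem_confRegion {S : (Fin dY → ℝ) → ℝ≥0} {KS1 KS2 η : ℝ}
    (hS : AggregatorCondition S KS1 KS2) {n : ℕ} (hn : 3 ≤ n) {z : Fin n → Obs dX dW}
    {σ c : ℝ} {θ : EuclideanSpace ℝ (Fin d)} (hθ : θ ∈ M.confRegion S z σ c) (hη : 0 < η)
    (hc : c * √(Real.log n / n) ≤ η) {g : EuclideanSpace ℝ (Fin dX) → Fin dY → ℝ} (hg : g ∈ M.G)
    (j : Fin dY) :
    -(η * KS2) ≤ empMean z (M.moment θ g j) / max (empSD z (M.moment θ g j)) σ := by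
  have hlog := one_le_log_natCast hn
  have hn' : (0 : ℝ) < n := by positivity
  set t : Fin dY → ℝ := fun j => empMean z (M.moment θ g j) / max (empSD z (M.moment θ g j)) σ
  refine (hS.2 η hη t).2 (le_trans ?_ hc) j
  have h1 : ((ENNReal.ofReal (√(n : ℝ) / √(Real.log n)) * (S t : ℝ≥0∞) : ℝ≥0∞) : EReal)
      ≤ (c : EReal) := by
    refine le_trans (EReal.coe_ennreal_le_coe_ennreal_iff.2 ?_) hθ.2
    gcongr
    exact le_iSup₂ (f := fun g (_ : g ∈ M.G) => (S (fun j => empMean z (M.moment θ g j) /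
      max (empSD z (M.moment θ g j)) σ) : ℝ≥0∞)) g hg
  rw [← ENNReal.ofReal_coe_nnreal, ← ENNReal.ofReal_mul (by positivity),
    EReal.coe_ennreal_ofReal, max_eq_left (by positivity)] at h1
  have h2 : √(n : ℝ) / √(Real.log n) * S t ≤ c := EReal.coe_le_coe_iff.1 h1
  calc (S t : ℝ) = √(n : ℝ) / √(Real.log n) * S t * √(Real.log n / n) := by
        rw [Real.sqrt_div' _ hn'.le]
        field_simp
    _ ≤ c * √(Real.log n / n) := by gcongr

/-- Everywhere valid bounds for the moment functions. -/
theorem abs_moment_le {Ybar A V : ℝ} (hA : 0 < A) (hcov : M.CoveringCondition Ybar A V)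
    {θ : EuclideanSpace ℝ (Fin d)} (hθ : θ ∈ M.Θ)
    {g : EuclideanSpace ℝ (Fin dX) → Fin dY → ℝ} (hg : g ∈ M.G) (j : Fin dY) (z : Obs dX dW) :
    |M.moment θ g j z| ≤ A * 2 ^ V := by
  refine abs_le_of_empiricalCovering ((hcov j).1.empiricalCovering hA.le fun s => ?_) z
  have h1 : (1 : ℝ) ≤ max Ybar 1 := le_max_right _ _
  exact ⟨θ, hθ, g, hg, s, ⟨by linarith [s.2.1], by linarith [s.2.2]⟩, 0,
    ⟨by linarith, by linarith⟩, by simp⟩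

/-- The studentized deviation inequality for the moment functions multiplied by a sign. -/
theorem pi_signed_moment_deviation_le {Ybar A V : ℝ} (hM : M.IsMeasurable) (hA : 0 < A)
    (hV : 0 < V) (hcov : M.CoveringCondition Ybar A V) (hb : M.BoundedMoments Ybar)
    {P : ProbabilityMeasure (Obs dX dW)} (hP : P ∈ M.P) (j : Fin dY) {b : ℝ} (hb1 : |b| = 1)
    {n : ℕ} (hn : 3 ≤ n) (hnV : 288 * (16 * (V + 1)) * (Real.log n / n) ≤ 1) :
    (Measure.pi fun _ : Fin n => (P : Measure (Obs dX dW))) {z | ∃ θ ∈ M.Θ, ∃ g ∈ M.G,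
        ratioConst V (max Ybar 1) * √(Real.log n / n) *
            max (empSD z fun x => b * M.moment θ g j x) √(Real.log n / n)
          < ∫ x, b * M.moment θ g j x ∂(P : Measure (Obs dX dW))
            - empMean z fun x => b * M.moment θ g j x}
      ≤ 2 * ENNReal.ofReal (A * (4 * max Ybar 1) ^ V * (8 * (4 * max Ybar 1 ^ 2)) ^ V / n)
        + 2 * ENNReal.ofReal (A * (8 * (A * 2 ^ V + 1)) ^ V / n) := by
  obtain ⟨hΘ, hm, T, _, _, γ, hγ, hG⟩ := id hM
  have hstd : StandardBorelSpace M.Θ := hΘ.standardBorel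
  have hγG : ∀ t, γ t ∈ M.G := fun t => hG ▸ mem_range_self t
  have hY : 1 ≤ max Ybar 1 := le_max_right _ _
  let F : M.Θ × T → Obs dX dW → ℝ := fun i z => b * M.moment i.1 (γ i.2) j z
  have hFm : Measurable (Function.uncurry F) := by
    have h1 : Measurable fun p : (M.Θ × T) × Obs dX dW => M.m p.2.2 p.1.1 j :=
      (measurable_pi_apply j).comp (hm.comp ((measurable_snd.comp measurable_snd).prodMk
        (measurable_fst.comp measurable_fst)))
    have h2 : Measurable fun p : (M.Θ × T) × Obs dX dW => γ p.1.2 p.2.1 j :=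
      (measurable_pi_apply j).comp (hγ.comp ((measurable_snd.comp measurable_fst).prodMk
        (measurable_fst.comp measurable_snd)))
    exact (h1.mul h2).const_mul b
  have habs : ∀ i z, |F i z| = |M.moment i.1 (γ i.2) j z| := fun i z => by
    rw [abs_mul, hb1, one_mul]
  have hbI := abs_le.1 hb1.le
  refine (measure_mono ?_).trans (pi_integral_sub_empMean_gt_le (P : Measure (Obs dX dW)) hFm hA hV
    (by linarith [show 0 < A * 2 ^ V by positivity] : 1 ≤ A * 2 ^ V + 1) hY
    (fun t ht => (hcov j).1.empiricalCovering hA.le fun i => ?_) (fun i z => ?_) (fun i => ?_)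
    hn hnV)
  · rintro z ⟨θ, hθ, g, hg, h⟩
    rw [hG] at hg
    obtain ⟨t, rfl⟩ := hg
    exact ⟨(⟨θ, hθ⟩, t), h⟩
  · have ht' := abs_le.1 (ht i)
    exact ⟨i.1, i.1.2, γ i.2, hγG _, b, ⟨by linarith, by linarith⟩, t i, ht', rfl⟩
  · rw [habs]
    linarith [M.abs_moment_le hA hcov i.1.2 (hγG i.2) j z]
  · filter_upwards [hb P hP i.1 i.1.2 _ (hγG i.2) j] with z hz
    rw [habs]
    exact hz.trans (le_max_left _ _)

end Model

theorem tendsto_log_div_natCast : Tendsto (fun n : ℕ => Real.log n / n) atTop (𝓝 0) :=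
  Real.isLittleO_log_id_atTop.tendsto_div_nhds_zero.comp
    (tendsto_natCast_atTop_atTop (R := ℝ))

theorem tendsto_ofReal_const_div (x : ℝ) :
    Tendsto (fun n : ℕ => ENNReal.ofReal (x / n)) atTop (𝓝 0) := by
  have := ENNReal.tendsto_ofReal (tendsto_const_div_atTop_nhds_zero_nat x)
  simpa using this

namespace Model

variable {dX dW dY d : ℕ} {M : Model dX dW dY d}

/-- On samples without large studentized deviations, the set estimate is Hausdorff close to the
identified set. -/
theorem hausdorffEDist_confRegion_le (hM : M.IsMeasurable) (hG : M.InstrumentsNonneg)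
    {Ybar B b : ℝ} (hbd : M.BoundedMoments Ybar) {S : (Fin dY → ℝ) → ℝ≥0} {KS1 KS2 K C : ℝ}
    (hS : AggregatorCondition S KS1 KS2) (hKS1 : 0 < KS1) (hKS2 : 0 < KS2) (hK : 1 ≤ K)
    (hCK : C < K * KS1) (hC : 0 ≤ C) (hB : 0 ≤ B)
    (hMB : ∀ θ ∈ M.Θ, ∀ g ∈ M.G, ∀ j z, |M.moment θ g j z| ≤ B)
    {P : ProbabilityMeasure (Obs dX dW)} (hP : P ∈ M.P) {ε δ : ℝ} (hδ : 0 < δ)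
    (hviol : ∀ θ ∈ M.Θ, ENNReal.ofReal ε < Metric.infEDist θ (M.identifiedSet P) →
      ∃ g ∈ M.G, ∃ j, ∫ z, M.moment θ g j z ∂(P : Measure (Obs dX dW)) < -δ)
    {n : ℕ} (hn : 3 ≤ n) {z : Fin n → Obs dX dW} {σ a c : ℝ} (hσb : σ ≤ b)
    (haσ : a ≤ σ * √((n : ℝ) / Real.log n)) (haK : K ≤ a) (hcK : K ≤ c)
    (hc : c * √(Real.log n / n) ≤ δ / (4 * KS2 * (B + |b| + 1)))
    (hsmall : C * √(Real.log n / n) * (B + 1) ≤ δ / 4)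
    (hlow : ∀ θ ∈ M.Θ, ∀ g ∈ M.G, ∀ j, ∫ x, M.moment θ g j x ∂(P : Measure (Obs dX dW))
        - empMean z (M.moment θ g j) ≤
      C * √(Real.log n / n) * max (empSD z (M.moment θ g j)) √(Real.log n / n))
    (hup : ∀ θ ∈ M.Θ, ∀ g ∈ M.G, ∀ j, empMean z (M.moment θ g j)
        - ∫ x, M.moment θ g j x ∂(P : Measure (Obs dX dW)) ≤
      C * √(Real.log n / n) * max (empSD z (M.moment θ g j)) √(Real.log n / n)) :
    Metric.hausdorffEDist (M.identifiedSet P) (M.confRegion S z σ c) ≤ ENNReal.ofReal ε := by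
  have hlog := one_le_log_natCast hn
  have hn' : (0 : ℝ) < n := by positivity
  have hL : 0 < √(Real.log n / n) := by positivity
  have hL1 : √(Real.log n / n) ≤ 1 := by
    rw [Real.sqrt_le_iff, one_pow, div_le_one hn']
    exact ⟨zero_le_one, by linarith [Real.log_le_sub_one_of_pos hn']⟩
  have hσ : √(Real.log n / n) ≤ σ := by
    have h1 : 1 ≤ σ * √((n : ℝ) / Real.log n) := hK.trans (haK.trans haσ)
    rw [← inv_div, Real.sqrt_inv, ← div_eq_mul_inv, le_div_iff₀ hL, one_mul] at h1
    exact h1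
  refine Metric.hausdorffEDist_le_of_infEDist (fun θ hθ => ?_) fun θ hθ => ?_
  · rw [Metric.infEDist_zero_of_mem]
    · exact zero_le
    · refine mem_confRegion_of_empMean_ge hS hKS1 hn hθ.1 (by linarith) hCK hC hcK hσ
        fun g hg j => ?_
      linarith [hlow θ hθ.1 g hg j, integral_moment_nonneg hM hG hbd hP hθ hg j]
  · by_contra! hcon
    obtain ⟨g, hg, j, hj⟩ := hviol θ hθ.1 hcon
    have hη : 0 < δ / (4 * KS2 * (B + |b| + 1)) := by positivity
    have ht := le_studentized_of_mem_confRegion hS hn hθ hη hc hg j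
    have hSD := empSD_le (by omega : 0 < n) z hB (hMB θ hθ.1 g hg j)
    have hden : 0 < max (empSD z (M.moment θ g j)) σ := lt_max_of_lt_right (hL.trans_le hσ)
    have hden' : max (empSD z (M.moment θ g j)) σ ≤ B + |b| + 1 :=
      max_le (by linarith [abs_nonneg b]) (by linarith [le_abs_self b])
    rw [le_div_iff₀ hden] at ht
    have hKη : δ / (4 * KS2 * (B + |b| + 1)) * KS2 * max (empSD z (M.moment θ g j)) σ ≤ δ / 4 := by
      calc _ ≤ δ / (4 * KS2 * (B + |b| + 1)) * KS2 * (B + |b| + 1) := by gcongr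
        _ = δ / 4 := by
          have : 0 < B + |b| + 1 := by positivity
          field_simp
    have hdev : C * √(Real.log n / n) * max (empSD z (M.moment θ g j)) √(Real.log n / n)
        ≤ δ / 4 := by
      refine le_trans ?_ hsmall
      gcongr
      exact max_le (by linarith) (by linarith)
    linarith [hup θ hθ.1 g hg j]

end Model

end CondMomIneq

theorem theorem2 (V Ybar KS1 : ℝ) (hV : 0 < V) (hYbar : 0 ≤ Ybar) (hKS1 : 0 < KS1) :
    ∃ K0 : ℝ, ∀ (dX dW dY d : ℕ) (M : CondMomIneq.Model dX dW dY d)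
      (S : (Fin dY → ℝ) → ℝ≥0) (A KS2 K : ℝ)
      (σ a c : (n : ℕ) → (Fin n → CondMomIneq.Obs dX dW) → ℝ),
      0 < A → 0 < KS2 → K0 < K →
      M.IsMeasurable →
      M.InstrumentsNonneg →
      M.CoveringCondition Ybar A V →
      M.BoundedMoments Ybar →
      CondMomIneq.AggregatorCondition S KS1 KS2 →
      M.CutoffCondition σ a →
      CondMomIneq.UniformlyNegligible M.P (fun _ n => {z | a n z < K ∨ c n z < K}) →
      M.UniformViolation →
      (∀ η : ℝ, 0 < η → CondMomIneq.UniformlyNegligible M.P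
        (fun _ n => {z | η < c n z * √(Real.log n / n)})) →
      ∀ ε : ℝ, 0 < ε → CondMomIneq.UniformlyNegligible M.P
        (fun P n => {z | ENNReal.ofReal ε <
          Metric.hausdorffEDist (M.identifiedSet P) (M.confRegion S z (σ n z) (c n z))}) := by
  open CondMomIneq in
  have hC : 0 < ratioConst V (max Ybar 1) := by
    have : (0 : ℝ) < max Ybar 1 := lt_max_of_lt_right one_pos
    unfold ratioConst squareConst
    positivity
  set C := CondMomIneq.ratioConst V (max Ybar 1) with hCdef
  refine ⟨max 1 (C / KS1), fun dX dW dY d M S A KS2 K σ a c hA hKS2 hK hM hG hcov hbd hS hcut hac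
    hviol hcsmall ε hε => ?_⟩
  obtain ⟨hK1, hCK⟩ := max_lt_iff.1 hK
  rw [div_lt_iff₀ hKS1] at hCK
  obtain ⟨⟨b, hb⟩, hσa⟩ := hcut
  obtain ⟨δ, hδ, hviolδ⟩ := hviol ε hε
  set B := A * 2 ^ V with hB
  have hB0 : 0 < B := by positivity
  set u : ℕ → ℝ≥0∞ := fun n =>
    2 * ENNReal.ofReal (A * (4 * max Ybar 1) ^ V * (8 * (4 * max Ybar 1 ^ 2)) ^ V / n)
      + 2 * ENNReal.ofReal (A * (8 * (B + 1)) ^ V / n) with hu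
  have hu0 : Tendsto u atTop (𝓝 0) := by
    have h1 := ENNReal.Tendsto.const_mul (a := 2) (CondMomIneq.tendsto_ofReal_const_div
      (A * (4 * max Ybar 1) ^ V * (8 * (4 * max Ybar 1 ^ 2)) ^ V)) (Or.inr (by norm_num))
    have h2 := ENNReal.Tendsto.const_mul (a := 2) (CondMomIneq.tendsto_ofReal_const_div
      (A * (8 * (B + 1)) ^ V)) (Or.inr (by norm_num))
    simpa using h1.add h2
  have hu1 : Tendsto (fun n => ∑ _j : Fin dY, (u n + u n)) atTop (𝓝 0) := by
    have := tendsto_finsetSum (Finset.univ : Finset (Fin dY)) fun _ _ => hu0.add hu0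
    simpa using this
  refine CondMomIneq.UniformlyNegligible.of_eventually_le hu1 hac
    (hcsmall (δ / (4 * KS2 * (B + |b| + 1))) (by positivity)) ?_
  have hlim1 : Tendsto (fun n : ℕ => 288 * (16 * (V + 1)) * (Real.log n / n)) atTop (𝓝 0) := by
    simpa using CondMomIneq.tendsto_log_div_natCast.const_mul (288 * (16 * (V + 1)))
  have hlim2 : Tendsto (fun n : ℕ => C * √(Real.log n / n) * (B + 1)) atTop (𝓝 0) := by
    simpa using ((CondMomIneq.tendsto_log_div_natCast.sqrt).const_mul C).mul_const (B + 1)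
  filter_upwards [eventually_ge_atTop 3, hlim1.eventually_le_const one_pos,
    hlim2.eventually_le_const (by positivity : 0 < δ / 4)] with n hn hnV hsmall P hP
  set ν := Measure.pi fun _ : Fin n => (P : Measure (CondMomIneq.Obs dX dW)) with hν
  let Dev : ℝ → Fin dY → Set (Fin n → CondMomIneq.Obs dX dW) := fun s j =>
    {z | ∃ θ ∈ M.Θ, ∃ g ∈ M.G,
      C * √(Real.log n / n) * max (CondMomIneq.empSD z fun x => s * M.moment θ g j x)
          √(Real.log n / n)
        < ∫ x, s * M.moment θ g j x ∂(P : Measure (CondMomIneq.Obs dX dW))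
          - CondMomIneq.empMean z fun x => s * M.moment θ g j x}
  have hDev : ∀ j, ν (Dev 1 j ∪ Dev (-1) j) ≤ u n + u n := fun j =>
    (measure_union_le _ _).trans (add_le_add
      (M.pi_signed_moment_deviation_le hM hA hV hcov hbd hP j (by simp) hn hnV)
      (M.pi_signed_moment_deviation_le hM hA hV hcov hbd hP j (by simp) hn hnV))
  have hDevs : ν (⋃ j, (Dev 1 j ∪ Dev (-1) j)) ≤ ∑ _j : Fin dY, (u n + u n) :=
    (measure_iUnion_fintype_le _ _).trans (Finset.sum_le_sum fun j _ => hDev j)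
  refine le_trans ?_ ((measure_union_le _ _).trans (add_le_add_left
    ((measure_union_le _ _).trans (add_le_add_left hDevs _)) _))
  refine measure_mono_ae ?_
  filter_upwards [hb n (by omega) P hP, hσa n (by omega) P hP] with z hzb hza hz
  by_contra hcon
  have hcon' : ¬ (z ∈ (⋃ j, (Dev 1 j ∪ Dev (-1) j)) ∪ {z | a n z < K ∨ c n z < K} ∪
    {z | δ / (4 * KS2 * (B + |b| + 1)) < c n z * √(Real.log n / n)}) := hcon
  simp only [mem_union, mem_iUnion, mem_ofPred_eq, not_or, not_exists, not_lt] at hcon'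
  obtain ⟨⟨hdev, ha, hc⟩, hcs⟩ := hcon'
  refine absurd (show ENNReal.ofReal ε < _ from hz) (not_lt.2 ?_)
  refine M.hausdorffEDist_confRegion_le hM hG hbd hS hKS1 hKS2 hK1.le hCK hC.le hB0.le
    (fun θ hθ g hg j z => M.abs_moment_le hA hcov hθ hg j z) hP hδ (hviolδ P hP) hn hzb hza ha hc
    hcs hsmall (fun θ hθ g hg j => ?_) fun θ hθ g hg j => ?_
  · by_contra! h
    exact (hdev j).1 ⟨θ, hθ, g, hg, by simpa using h⟩
  · by_contra! h
    refine (hdev j).2 ⟨θ, hθ, g, hg, ?_⟩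
    simp only [neg_one_mul, CondMomIneq.empSD_neg, CondMomIneq.empMean_neg, integral_neg]
    linarith
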